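/- **Setting.** Let $M=G/K$ be an $n$-dimensional homogeneous space: $G$ is a Lie group acting smoothly and transitively on the smooth manifold $M$, $K$ is the isotropy group of a point $o\in M$, and $g\mapsto g\cdot o$ is a submersion. Write $\mathfrak p=T_oM$. *Geometric structures.* Fix a model $\gamma_0$, which is a tensor or a finite system of tensors (of arbitrary covariant and contravariant degrees) on $\mathbb R^n$. For tensors of the same degrees on a finite-dimensional real vector space $V$, let $h\cdot\gamma=(h^{-1})^*\gamma$ be the natural action of $\mathrm{GL}(V)$, and let $\theta(A)\gamma=\frac{d}{dt}\big|_{0}\,e^{tA}\cdot\gamma$ for $A\in\mathfrak{gl}(V)$. A *geometric structure* is a smooth (system of) tensor field(s) $\gamma$ on $M$ such that for every $x\in M$ there is a linear isomorphism $e:T_xM\to\mathbb R^n$ with $\gamma_x=e^*\gamma_0$. Fix a linear complement $\mathfrak q$ of the stabilizer algebra $\mathfrak g_{\gamma_0}=\{A\in\mathfrak{gl}_n(\mathbb R):\theta(A)\gamma_0=0\}$ in $\mathfrak{gl}_n(\mathbb R)$ that is $\mathrm{Ad}(G_{\gamma_0})$-invariant, where $G_{\gamma_0}=\{h:h\cdot\gamma_0=\gamma_0\}$,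 and set $\mathfrak q_{\gamma}=e^{-1}\mathfrak q\,e$ if $\gamma=e^*\gamma_0$. *The flow.* Let $q$ assign to each geometric structure $\gamma$ on $M$ a smooth tensor field $q(\gamma)$ of the same type, i.e. $q(\gamma)_x\in\theta(\mathfrak{gl}(T_xM))\gamma_x$ for all $x$. Assume that $q$ is diffeomorphism invariant, $q(\varphi^*\gamma)=\varphi^*q(\gamma)$ for all $\varphi\in\mathrm{Diff}(M)$ and all geometric structures $\gamma$, and that $q$ depends smoothly on $G$-invariant structures: if $(\gamma^u)_{u\in U}$, with $U\subset\mathbb R^k$ open, are $G$-invariant geometric structures and $u\mapsto\gamma^u_o$ is smooth, then $u\mapsto q(\gamma^u)_o$ is smooth. *The solution.* Let $-\infty\le T_-<0<T_+\le\infty$, and let $\gamma(t)$, $t\in(T_-,T_+)$, be $G$-invariant geometric structures on $M$ with $\frac{\partial}{\partial t}\gamma(t)=q(\gamma(t))$. We say that $\gamma(t)$ has a finite-time singularity at $T_+$ if $T_+<\infty$ and $\gamma(t)$ does not extend to a $G$-invariant solution on $(T_-,T')$ for any $T'>T_+$; a finite-time singularity at $T_-$ is defined analogously. *The norms.* For $t\in(T_-,T_+)$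 let $Q(t)\in\mathfrak q_{\gamma(t)_o}\subset\mathrm{End}(\mathfrak p)$ be the unique operator with $\theta(Q(t))\gamma(t)_o=q(\gamma(t))_o$, and let $h(t)\in\mathrm{GL}(\mathfrak p)$ be the solution on $(T_-,T_+)$ of the linear equation $h'(t)=-h(t)Q(t)$, $h(0)=I$. Fix an inner product $\langle\cdot,\cdot\rangle$ on $\mathfrak p$, and let $|\cdot|_t$ be the norm on tensors on $\mathfrak p$ induced by the inner product $\langle\cdot,\cdot\rangle_t=h(t)^*\langle\cdot,\cdot\rangle=\langle h(t)\cdot,h(t)\cdot\rangle$, that is, the square root of the sum of the squares of the components with respect to a $\langle\cdot,\cdot\rangle_t$-orthonormal basis. **Proposition.** If $\gamma(t)$ has a finite-time singularity at $T_+$, then $$\int_0^{T_+}|q(\gamma(t))_o|_t\,dt=\infty,$$ and if $\gamma(t)$ has a finite-time singularity at $T_-$, then $$\int_{T_-}^0|q(\gamma(t))_o|_t\,dt=\infty.$$ -/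

import Mathlib

open scoped Manifold ContDiff ENNReal
open MeasureTheory

noncomputable section

namespace HomogeneousFlow

/-- The model space `ℝⁿ`. -/
abbrev Model (n : ℕ) : Type := EuclideanSpace ℝ (Fin n)

section Tensors

variable {N : ℕ} (r s : Fin N → ℕ)

/-- A system of `N` tensors on `V`; the `k`-th one is `r k` times covariant and `s k` times
contravariant, i.e. it takes `r k` vectors and `s k` covectors as arguments. -/
abbrev MixedTensor (V : Type*) [AddCommGroup V] [Module ℝ V] : Type _ :=
  ∀ k : Fin N, MultilinearMap ℝ (fun _ : Fin (r k) => V)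
    (MultilinearMap ℝ (fun _ : Fin (s k) => Module.Dual ℝ V) ℝ)

variable {r s}
variable {V : Type*} [AddCommGroup V] [Module ℝ V] {W : Type*} [AddCommGroup W] [Module ℝ W]

/-- `(v, α) ↦ τ (A v, α ∘ B)`, for `A : V → W` and `B : W → V`. -/
def MixedTensor.comap (A : V →ₗ[ℝ] W) (B : W →ₗ[ℝ] V) (τ : MixedTensor r s W) :
    MixedTensor r s V := fun k =>
  (MultilinearMap.compLinearMapₗ (fun _ : Fin (s k) => B.dualMap)).compMultilinearMap
    ((τ k).compLinearMap fun _ => A)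

theorem MixedTensor.comap_apply (A : V →ₗ[ℝ] W) (B : W →ₗ[ℝ] V) (τ : MixedTensor r s W)
    (k : Fin N) (v : Fin (r k) → V) (α : Fin (s k) → Module.Dual ℝ V) :
    MixedTensor.comap A B τ k v α = τ k (fun i => A (v i)) (fun j => α j ∘ₗ B) := rfl

/-- The pullback `e^*τ` of tensors by a linear isomorphism; `h · τ = (h⁻¹)^*τ` is the natural left
action of the general linear group. -/
def MixedTensor.pull (e : V ≃ₗ[ℝ] W) (τ : MixedTensor r s W) : MixedTensor r s V :=
  MixedTensor.comap e.toLinearMap e.symm.toLinearMap τ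

theorem update_id_apply {U : Type*} [AddCommGroup U] [Module ℝ U] {d : ℕ} (C : Module.End ℝ U)
    (i : Fin d) (v : Fin d → U) :
    (fun l => (Function.update (fun _ : Fin d => (LinearMap.id : Module.End ℝ U)) i C) l (v l))
      = Function.update v i (C (v i)) := by
  ext l
  by_cases h : l = i
  · subst h; simp
  · simp [h]

/-- The infinitesimal action `A ↦ θ(A)τ`, the derivative at `t = 0` of `exp(tA) · τ`:
`(θ(A)τ)(v, α) = ∑ j, τ(v, …, α_j ∘ A, …) - ∑ i, τ(…, A v_i, …, α)`. -/
def MixedTensor.theta (τ : MixedTensor r s V) : Module.End ℝ V →ₗ[ℝ] MixedTensor r s V where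
  toFun A := fun k =>
    (∑ j : Fin (s k), (MultilinearMap.compLinearMapₗ
        (Function.update (fun _ : Fin (s k) => LinearMap.id) j A.dualMap)).compMultilinearMap (τ k))
    - ∑ i : Fin (r k), (τ k).compLinearMap
        (Function.update (fun _ : Fin (r k) => LinearMap.id) i A)
  map_add' A B := by
    ext k v α
    have hAB : (A + B).dualMap = A.dualMap + B.dualMap := by ext; simp
    simp only [hAB, Pi.add_apply, sub_apply, add_apply, sum_apply,
      LinearMap.compMultilinearMap_apply, MultilinearMap.compLinearMapₗ_apply,
      MultilinearMap.compLinearMap_apply, update_id_apply, LinearMap.add_apply,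
      MultilinearMap.map_update_add, Finset.sum_add_distrib]
    ring
  map_smul' c A := by
    ext k v α
    have hA : (c • A).dualMap = c • A.dualMap := by ext; simp
    simp only [hA, Pi.smul_apply, sub_apply, smul_apply, sum_apply,
      LinearMap.compMultilinearMap_apply, MultilinearMap.compLinearMapₗ_apply,
      MultilinearMap.compLinearMap_apply, update_id_apply, LinearMap.smul_apply,
      MultilinearMap.map_update_smul, RingHom.id_apply, smul_sub, Finset.smul_sum]

theorem MixedTensor.theta_apply (τ : MixedTensor r s V) (A : Module.End ℝ V) (k : Fin N)
    (v : Fin (r k) → V) (α : Fin (s k) → Module.Dual ℝ V) :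
    MixedTensor.theta τ A k v α = ∑ j, τ k v (Function.update α j (α j ∘ₗ A))
      - ∑ i, τ k (Function.update v i (A (v i))) α := by
  simp only [MixedTensor.theta, LinearMap.coe_mk, AddHom.coe_mk, sub_apply,
    sum_apply, LinearMap.compMultilinearMap_apply, MultilinearMap.compLinearMapₗ_apply,
    MultilinearMap.compLinearMap_apply, update_id_apply]
  rfl

/-- The Lie algebra of the stabilizer of `τ`. -/
def MixedTensor.stabilizerAlgebra (τ : MixedTensor r s V) : Submodule ℝ (Module.End ℝ V) :=
  LinearMap.ker (MixedTensor.theta τ)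

variable {n : ℕ}

/-- `𝔮` is an `Ad`-invariant complement of the Lie algebra of the stabilizer of `γ₀`. -/
structure IsInvariantComplement (γ₀ : MixedTensor r s (Model n))
    (𝔮 : Submodule ℝ (Module.End ℝ (Model n))) : Prop where
  isCompl : IsCompl (MixedTensor.stabilizerAlgebra γ₀) 𝔮
  conj_mem : ∀ h : Model n ≃ₗ[ℝ] Model n, MixedTensor.pull h γ₀ = γ₀ → ∀ A ∈ 𝔮, h.conj A ∈ 𝔮

/-- The complement `𝔮_δ` at a tensor `δ = e^*γ₀`, transported from `𝔮` by the isomorphism `e`. If `𝔮`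
is an invariant complement at `γ₀`, it does not depend on the choice of `e`. -/
def complementAt (γ₀ : MixedTensor r s (Model n)) (𝔮 : Submodule ℝ (Module.End ℝ (Model n)))
    (δ : MixedTensor r s V) : Set (Module.End ℝ V) :=
  {A | ∃ e : V ≃ₗ[ℝ] Model n, δ = MixedTensor.pull e γ₀ ∧ e.conj A ∈ 𝔮}

/-- The Euclidean norm of a tensor on `ℝⁿ`: the root of the sum of the squares of its components. -/
def euclideanNorm (τ : MixedTensor r s (Model n)) : ℝ :=
  Real.sqrt (∑ k : Fin N, ∑ i : Fin (r k) → Fin n, ∑ j : Fin (s k) → Fin n,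
    (τ k (fun l => EuclideanSpace.single (i l) 1)
      (fun l => (EuclideanSpace.proj (j l) : Model n →L[ℝ] ℝ).toLinearMap)) ^ 2)

/-- The norm of a tensor on `V` for the inner product `ip`: its Euclidean norm in an orthonormal
frame. All orthonormal frames `b` give the same value, so the supremum only selects this value. -/
def tensorNorm (n : ℕ) (ip : LinearMap.BilinForm ℝ V) (τ : MixedTensor r s V) : ℝ≥0∞ :=
  ⨆ (b : Model n ≃ₗ[ℝ] V) (_ : ∀ v w, ip (b v) (b w) = inner ℝ v w),
    ENNReal.ofReal (euclideanNorm (MixedTensor.pull b τ))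

/-- The pullback `h^*ip` of a bilinear form, `(v, w) ↦ ip (h v) (h w)`. -/
def pullForm (h : V ≃ₗ[ℝ] V) (ip : LinearMap.BilinForm ℝ V) : LinearMap.BilinForm ℝ V :=
  ip.compl₁₂ h.toLinearMap h.toLinearMap

end Tensors

section Fields

variable {N : ℕ} (n : ℕ) (r s : Fin N → ℕ)
  (M : Type*) [TopologicalSpace M] [ChartedSpace (Model n) M]

/-- Systems of tensor fields (with no regularity) on the `n`-manifold `M`. -/
abbrev TensorField : Type _ := ∀ x : M, MixedTensor r s (TangentSpace (𝓡 n) x)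

variable {n r s M} [IsManifold (𝓡 n) ∞ M]

/-- Smoothness of tensor fields: read in the local frames of the tangent bundle that are given by
the charts, the components are smooth functions. -/
def IsSmoothField (τ : TensorField n r s M) : Prop :=
  ∀ (x₀ : M) (k : Fin N) (v : Fin (r k) → Model n) (α : Fin (s k) → Module.Dual ℝ (Model n)),
    ContMDiffAt (𝓡 n) 𝓘(ℝ, ℝ) ∞ (fun x : M => MixedTensor.comap
      ((trivializationAt (Model n) (TangentSpace (𝓡 n)) x₀).symmₗ ℝ x)
      ((trivializationAt (Model n) (TangentSpace (𝓡 n)) x₀).linearMapAt ℝ x) (τ x) k v α) x₀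

/-- The pullback `φ^*τ` of a tensor field by a diffeomorphism. -/
def pullback (φ : M ≃ₘ^∞⟮𝓡 n, 𝓡 n⟯ M) (τ : TensorField n r s M) : TensorField n r s M :=
  fun x => MixedTensor.pull (φ.mfderivToContinuousLinearEquiv (by simp) x).toLinearEquiv (τ (φ x))

/-- Geometric structures of the class with model tensor `γ₀`: smooth tensor fields which at each
point are equivalent to `γ₀` by a linear isomorphism (the non-degenerate tensor fields of the
given type). -/
structure IsGeometricStructure (γ₀ : MixedTensor r s (Model n)) (δ : TensorField n r s M) :
    Prop where
  smooth : IsSmoothField δ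
  nondegenerate : ∀ x, ∃ e : TangentSpace (𝓡 n) x ≃ₗ[ℝ] Model n, δ x = MixedTensor.pull e γ₀

/-- The right-hand side of a geometric flow: `q` assigns to each geometric structure `δ` a smooth
tensor field `q δ` of the same type as `δ`, i.e. with `q δ x ∈ θ(𝔤𝔩(T_x M)) δ_x`. -/
structure IsVelocity (γ₀ : MixedTensor r s (Model n))
    (q : TensorField n r s M → TensorField n r s M) : Prop where
  smooth : ∀ δ, IsGeometricStructure γ₀ δ → IsSmoothField (q δ)
  sameType : ∀ δ, IsGeometricStructure γ₀ δ → ∀ x,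
    q δ x ∈ LinearMap.range (MixedTensor.theta (δ x))

/-- Diffeomorphism invariance, `q(φ^*δ) = φ^*q(δ)`. -/
def IsDiffeomorphismInvariant (γ₀ : MixedTensor r s (Model n))
    (q : TensorField n r s M → TensorField n r s M) : Prop :=
  ∀ (φ : M ≃ₘ^∞⟮𝓡 n, 𝓡 n⟯ M) (δ : TensorField n r s M), IsGeometricStructure γ₀ δ →
    q (pullback φ δ) = pullback φ (q δ)

end Fields

section Homogeneous

variable {N : ℕ} {r s : Fin N → ℕ} {m n : ℕ}
  (G : Type*) [TopologicalSpace G] [ChartedSpace (Model m) G] [Group G] [LieGroup (𝓡 m) ∞ G]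
  {M : Type*} [TopologicalSpace M] [ChartedSpace (Model n) M] [IsManifold (𝓡 n) ∞ M]
  [MulAction G M] [ContMDiffSMul (𝓡 m) (𝓡 n) ∞ G M]

variable {G} in
/-- The diffeomorphism `x ↦ g • x` given by a smooth action. -/
def actionDiffeo (g : G) : M ≃ₘ^∞⟮𝓡 n, 𝓡 n⟯ M where
  toEquiv := MulAction.toPerm g
  contMDiff_toFun :=
    (contMDiff_smul (I := 𝓡 m) (I' := 𝓡 n) (G := G) (M := M)).comp
      (contMDiff_const.prodMk contMDiff_id)
  contMDiff_invFun :=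
    (contMDiff_smul (I := 𝓡 m) (I' := 𝓡 n) (G := G) (M := M)).comp
      (contMDiff_const (c := g⁻¹) |>.prodMk contMDiff_id)

/-- `M` is the homogeneous space `G/K`, with origin `o` and isotropy group `K = G_o`: the action is
transitive and the projection `g ↦ g • o` is a submersion. -/
structure IsHomogeneousSpace (o : M) : Prop where
  transitive : MulAction.IsPretransitive G M
  submersion : Function.Surjective (mfderiv (𝓡 m) (𝓡 n) (fun g : G => g • o) 1)

/-- `G`-invariance of a tensor field. -/
def IsInvariant (τ : TensorField n r s M) : Prop :=
  ∀ g : G, pullback (actionDiffeo (m := m) g) τ = τ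

/-- `q` depends smoothly on invariant structures: if an invariant structure `δ u` depends on
finitely many real parameters `u`, and smoothly so at the origin, then `q (δ u)` at the origin
depends smoothly on `u`. That is, the flow of invariant structures is a smooth ODE. -/
def IsSmoothOnInvariant (γ₀ : MixedTensor r s (Model n))
    (q : TensorField n r s M → TensorField n r s M) (o : M) : Prop :=
  ∀ (k : ℕ) (U : Set (Model k)) (δ : Model k → TensorField n r s M), IsOpen U →
    (∀ u ∈ U, IsGeometricStructure γ₀ (δ u) ∧ IsInvariant (m := m) G (δ u)) →
    (∀ i v α, ContDiffOn ℝ ∞ (fun u => δ u o i v α) U) →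
    ∀ i v α, ContDiffOn ℝ ∞ (fun u => q (δ u) o i v α) U

/-- The real numbers of the open interval with end points `a` and `b`. -/
def timeInterval (a b : EReal) : Set ℝ := {t : ℝ | a < (t : EReal) ∧ (t : EReal) < b}

/-- `γ` is a `G`-invariant solution of `∂γ/∂t = q(γ)` on the time interval `(a, b)`. -/
structure IsInvariantSolution (γ₀ : MixedTensor r s (Model n))
    (q : TensorField n r s M → TensorField n r s M) (γ : ℝ → TensorField n r s M) (a b : EReal) :
    Prop where
  geometric : ∀ t ∈ timeInterval a b, IsGeometricStructure γ₀ (γ t)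
  invariant : ∀ t ∈ timeInterval a b, IsInvariant (m := m) G (γ t)
  hasDerivAt : ∀ t ∈ timeInterval a b, ∀ (x : M) (k : Fin N)
    (v : Fin (r k) → TangentSpace (𝓡 n) x) (α : Fin (s k) → Module.Dual ℝ (TangentSpace (𝓡 n) x)),
    HasDerivAt (fun t' => γ t' x k v α) (q (γ t) x k v α) t

/-- The solution `γ` on `(a, b)` has a finite-time singularity at `b`: `b` is finite and `γ` does
not extend to an invariant solution beyond `b`. -/
def HasForwardSingularity (γ₀ : MixedTensor r s (Model n))
    (q : TensorField n r s M → TensorField n r s M) (γ : ℝ → TensorField n r s M) (a b : EReal) : Prop :=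
  b < ⊤ ∧ ¬ ∃ (b' : EReal) (γ' : ℝ → TensorField n r s M), b < b' ∧
    IsInvariantSolution (m := m) G γ₀ q γ' a b' ∧ ∀ t ∈ timeInterval a b, γ' t = γ t

/-- The solution `γ` on `(a, b)` has a finite-time singularity at `a`: `a` is finite and `γ` does
not extend to an invariant solution before `a`. -/
def HasBackwardSingularity (γ₀ : MixedTensor r s (Model n))
    (q : TensorField n r s M → TensorField n r s M) (γ : ℝ → TensorField n r s M) (a b : EReal) : Prop :=
  ⊥ < a ∧ ¬ ∃ (a' : EReal) (γ' : ℝ → TensorField n r s M), a' < a ∧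
    IsInvariantSolution (m := m) G γ₀ q γ' a' b ∧ ∀ t ∈ timeInterval a b, γ' t = γ t

end Homogeneous

section Gauge

variable {N : ℕ} {r s : Fin N → ℕ} {n : ℕ}
  {M : Type*} [TopologicalSpace M] [ChartedSpace (Model n) M] [IsManifold (𝓡 n) ∞ M]

/-- `h` is the curve in `GL(T_o M)` with `h'(t) = -h(t) Q(t)` and `h(0) = I`, where `Q(t)` is the
operator in `𝔮_{γ(t)}` with `θ(Q(t)) γ(t) = q(γ(t))` at the origin `o`. -/
def IsGaugeCurve (γ₀ : MixedTensor r s (Model n)) (𝔮 : Submodule ℝ (Module.End ℝ (Model n)))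
    (q : TensorField n r s M → TensorField n r s M) (γ : ℝ → TensorField n r s M) (a b : EReal) (o : M)
    (h : ℝ → TangentSpace (𝓡 n) o ≃ₗ[ℝ] TangentSpace (𝓡 n) o) : Prop :=
  h 0 = LinearEquiv.refl ℝ _ ∧
  ∀ t ∈ timeInterval a b, ∃ Q ∈ complementAt γ₀ 𝔮 (γ t o),
    MixedTensor.theta (γ t o) Q = q (γ t) o ∧
    ∀ v, HasDerivAt (fun t' => h t' v) (-(h t (Q v))) t

end Gauge

end HomogeneousFlow

end

noncomputable section

namespace HomogeneousFlow

/-! ### Pullbacks, the infinitesimal action and linear functionals on tensors. -/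

section TensorAlgebra

variable {N : ℕ} {r s : Fin N → ℕ}
variable {V : Type*} [AddCommGroup V] [Module ℝ V] {W : Type*} [AddCommGroup W] [Module ℝ W]
  {X : Type*} [AddCommGroup X] [Module ℝ X]

/-! Write `σ` for the value of `γ 0` at `o`. Since `h' = -hQ` and `θ(Q)γ = q(γ)` at `o`, the
derivative of `(h⁻¹)^*γ(t)_o` vanishes, so that `γ(t)_o = h(t)^*σ`: the flow is encoded in a curve
of operators (`gauge_equation`). Conjugating, `h' = -R h` with `R = hQh⁻¹`, and `R` lies in the
complement at the fixed tensor `σ`. It is therefore `L` of the velocity moved back by `h`, where `L`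
is one fixed linear section of `A ↦ θ(A)σ`. As the velocity at `h^*σ` is determined by `h`, this is
an autonomous equation `h' = -R(h) h`.

The isotropy group fixes `γ(t)_o` and its velocity. As the complement is `Ad`-invariant, `Q` is
unique and commutes with the isotropy representation, and so does `h` (`gauge_commute`). Conversely,
if an invertible `a` commutes with it, then `a^*σ` is fixed by the isotropy group and extends to an
invariant geometric structure, and `R(a)` commutes as well. The equation is thus a smooth ODE on the
invertible elements of a linear space of operators, and each of its integral curves gives an
invariant solution of the flow (`isInvariantSolution_gaugedField`).

By construction `h(t)` is an isometry from `⟨·,·⟩_t` to `⟨·,·⟩`. So the moving norm of the velocity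
is a fixed norm of the velocity moved back by `h`, and it dominates `‖R‖` up to a constant
(`exists_tensorNorm_bound`). If its integral is finite, then Gronwall's inequality for `h' = -R h`
bounds `h` from above and from below, `h` has an invertible limit (`exists_isUnit_limit`), and
Picard-Lindelöf continues it past the end point (`exists_operator_extension`). The continued curve
extends `γ`, which contradicts the singularity. Time reversal gives the other end. -/

theorem MixedTensor.pull_apply (e : V ≃ₗ[ℝ] W) (τ : MixedTensor r s W)
    (k : Fin N) (v : Fin (r k) → V) (α : Fin (s k) → Module.Dual ℝ V) :
    MixedTensor.pull e τ k v α = τ k (fun i => e (v i)) (fun j => α j ∘ₗ e.symm.toLinearMap) := rfl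

theorem MixedTensor.pull_pull (e : V ≃ₗ[ℝ] W) (f : W ≃ₗ[ℝ] X) (τ : MixedTensor r s X) :
    MixedTensor.pull e (MixedTensor.pull f τ) = MixedTensor.pull (e.trans f) τ := rfl

@[simp]
theorem MixedTensor.pull_refl (τ : MixedTensor r s V) :
    MixedTensor.pull (LinearEquiv.refl ℝ V) τ = τ := rfl

@[simp]
theorem MixedTensor.pull_pull_symm (e : V ≃ₗ[ℝ] W) (τ : MixedTensor r s V) :
    MixedTensor.pull e (MixedTensor.pull e.symm τ) = τ := by
  rw [MixedTensor.pull_pull, LinearEquiv.self_trans_symm, MixedTensor.pull_refl]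

@[simp]
theorem MixedTensor.pull_symm_pull (e : V ≃ₗ[ℝ] W) (τ : MixedTensor r s W) :
    MixedTensor.pull e.symm (MixedTensor.pull e τ) = τ := by
  rw [MixedTensor.pull_pull, LinearEquiv.symm_trans_self, MixedTensor.pull_refl]

/-- The pullback by a linear isomorphism, as a linear map between spaces of tensors. -/
def MixedTensor.pullₗ (e : V ≃ₗ[ℝ] W) : MixedTensor r s W →ₗ[ℝ] MixedTensor r s V where
  toFun := MixedTensor.pull e
  map_add' _ _ := rfl
  map_smul' _ _ := rfl

@[simp]
theorem MixedTensor.pullₗ_apply (e : V ≃ₗ[ℝ] W) (τ : MixedTensor r s W) :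
    MixedTensor.pullₗ e τ = MixedTensor.pull e τ := rfl

/-- Naturality of the infinitesimal action; in each slot, applying `A` after `e` is applying `e`
after `e⁻¹Ae`. -/
theorem MixedTensor.pull_theta (e : V ≃ₗ[ℝ] W) (τ : MixedTensor r s W) (A : Module.End ℝ W) :
    MixedTensor.pull e (MixedTensor.theta τ A)
      = MixedTensor.theta (MixedTensor.pull e τ) (e.symm.conj A) := by
  funext k
  ext v α
  simp only [MixedTensor.pull_apply, MixedTensor.theta_apply]
  congr 1
  · refine Finset.sum_congr rfl fun j _ => ?_
    congr 1
    funext l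
    by_cases h : l = j
    · subst h
      ext x
      simp [LinearEquiv.conj_apply]
    · simp [h]
  · refine Finset.sum_congr rfl fun i _ => ?_
    congr 2
    funext l
    by_cases h : l = i
    · subst h
      simp [LinearEquiv.conj_apply]
    · simp [h]

theorem MixedTensor.pull_symm_theta_pull (e : V ≃ₗ[ℝ] W) (τ : MixedTensor r s W)
    (A : Module.End ℝ V) :
    MixedTensor.pull e.symm (MixedTensor.theta (MixedTensor.pull e τ) A)
      = MixedTensor.theta τ (e.conj A) := by
  rw [MixedTensor.pull_theta, MixedTensor.pull_symm_pull, LinearEquiv.symm_symm]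

/-- Evaluation of tensors on vectors and covectors, as a linear functional. -/
def MixedTensor.eval (k : Fin N) (v : Fin (r k) → V) (α : Fin (s k) → Module.Dual ℝ V) :
    MixedTensor r s V →ₗ[ℝ] ℝ where
  toFun τ := τ k v α
  map_add' _ _ := rfl
  map_smul' _ _ := rfl

/-- A subspace of a finite-dimensional dual is the annihilator of its coannihilator, and the
coannihilator of a separating set is zero. -/
theorem dual_eq_span_of_separating {T : Type*} [AddCommGroup T] [Module ℝ T]
    [FiniteDimensional ℝ T] (S : Set (Module.Dual ℝ T)) (hS : ∀ t, (∀ φ ∈ S, φ t = 0) → t = 0) :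
    Submodule.span ℝ S = ⊤ := by
  have h : (Submodule.span ℝ S).dualCoannihilator = ⊥ := by
    rw [eq_bot_iff]
    intro t ht
    rw [Submodule.mem_dualCoannihilator] at ht
    exact hS t fun φ hφ => ht φ (Submodule.subset_span hφ)
  rw [← Subspace.dualCoannihilator_dualAnnihilator_eq (W := Submodule.span ℝ S), h,
    Submodule.dualAnnihilator_bot]

/-- Reduces bounds and smoothness of arbitrary functionals to components, so that the space of
tensors itself needs no norm. -/
theorem MixedTensor.dual_induction [FiniteDimensional ℝ V] {S : Set (Module.Dual ℝ (MixedTensor r s V))}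
    (hS : ∀ τ, (∀ φ ∈ S, φ τ = 0) → τ = 0)
    {P : Module.Dual ℝ (MixedTensor r s V) → Prop} (mem : ∀ φ ∈ S, P φ)
    (zero : P 0) (add : ∀ φ ψ, P φ → P ψ → P (φ + ψ)) (smul : ∀ (c : ℝ) φ, P φ → P (c • φ)) (φ) :
    P φ := by
  have h : φ ∈ Submodule.span ℝ S := by
    rw [dual_eq_span_of_separating (T := MixedTensor r s V) S hS]; trivial
  induction h using Submodule.span_induction with
  | mem x h => exact mem x h
  | zero => exact zero
  | add x y _ _ hx hy => exact add x y hx hy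
  | smul a x _ hx => exact smul a x hx

/-- A property of linear functionals on tensors that holds for evaluations holds for all. -/
theorem MixedTensor.dual_induction_eval [FiniteDimensional ℝ V]
    {P : Module.Dual ℝ (MixedTensor r s V) → Prop} (eval : ∀ k v α, P (MixedTensor.eval k v α))
    (zero : P 0) (add : ∀ φ ψ, P φ → P ψ → P (φ + ψ)) (smul : ∀ (c : ℝ) φ, P φ → P (c • φ)) (φ) :
    P φ := by
  refine MixedTensor.dual_induction (S := {φ | ∃ k v α, φ = MixedTensor.eval k v α}) ?_ ?_
    zero add smul φ
  · intro τ hτ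
    funext k
    ext v α
    exact hτ _ ⟨k, v, α, rfl⟩
  · rintro _ ⟨k, v, α, rfl⟩
    exact eval k v α

theorem abs_component_le_euclideanNorm {n : ℕ} (τ : MixedTensor r s (Model n)) (k : Fin N)
    (i : Fin (r k) → Fin n) (j : Fin (s k) → Fin n) :
    |τ k (fun l => EuclideanSpace.single (i l) 1)
      (fun l => (EuclideanSpace.proj (j l) : Model n →L[ℝ] ℝ).toLinearMap)| ≤ euclideanNorm τ := by
  rw [← Real.sqrt_sq_eq_abs, euclideanNorm]
  refine Real.sqrt_le_sqrt ?_
  refine le_trans ?_ (Finset.single_le_sum (fun _ _ => by positivity) (Finset.mem_univ k))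
  refine le_trans ?_ (Finset.single_le_sum (fun _ _ => by positivity) (Finset.mem_univ i))
  exact Finset.single_le_sum (f := fun j : Fin (s k) → Fin n => (τ k (fun l => EuclideanSpace.single (i l) 1)
      (fun l => (EuclideanSpace.proj (j l) : Model n →L[ℝ] ℝ).toLinearMap)) ^ 2)
    (fun _ _ => by positivity) (Finset.mem_univ j)

/-- A tensor with vanishing components vanishes. -/
theorem MixedTensor.eq_zero_of_components {n : ℕ} (τ : MixedTensor r s (Model n))
    (h : ∀ (k : Fin N) (i : Fin (r k) → Fin n) (j : Fin (s k) → Fin n),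
      τ k (fun l => EuclideanSpace.single (i l) 1)
        (fun l => (EuclideanSpace.proj (j l) : Model n →L[ℝ] ℝ).toLinearMap) = 0) : τ = 0 := by
  funext k
  let b := (EuclideanSpace.basisFun (Fin n) ℝ).toBasis
  have hb : ∀ j, b.dualBasis j = (EuclideanSpace.proj j : Model n →L[ℝ] ℝ).toLinearMap := by
    intro j
    refine b.ext fun i => ?_
    simp [b]
  refine Module.Basis.ext_multilinear (fun _ => b) fun i => ?_
  refine Module.Basis.ext_multilinear (fun _ => b.dualBasis) fun j => ?_
  simp only [hb]
  simpa [b] using h k i j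

/-- Every linear functional on tensors is bounded for the Euclidean norm. -/
theorem MixedTensor.exists_dual_bound {n : ℕ} (φ : Module.Dual ℝ (MixedTensor r s (Model n))) :
    ∃ C, 0 ≤ C ∧ ∀ τ, |φ τ| ≤ C * euclideanNorm τ := by
  refine MixedTensor.dual_induction
    (P := fun φ => ∃ C, 0 ≤ C ∧ ∀ τ, |φ τ| ≤ C * euclideanNorm τ) (S := {φ | ∃ (k : Fin N) (i : Fin (r k) → Fin n)
    (j : Fin (s k) → Fin n), φ = MixedTensor.eval k (fun l => EuclideanSpace.single (i l) 1)
        (fun l => (EuclideanSpace.proj (j l) : Model n →L[ℝ] ℝ).toLinearMap)}) ?_ ?_ ?_ ?_ ?_ φ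
  · exact fun τ hτ => MixedTensor.eq_zero_of_components τ fun k i j => hτ _ ⟨k, i, j, rfl⟩
  · rintro _ ⟨k, i, j, rfl⟩
    refine ⟨1, zero_le_one, fun τ => ?_⟩
    rw [one_mul]
    exact abs_component_le_euclideanNorm τ k i j
  · exact ⟨0, le_rfl, fun τ => by simp⟩
  · rintro φ ψ ⟨C, hC, hφ⟩ ⟨D, hD, hψ⟩
    refine ⟨C + D, add_nonneg hC hD, fun τ => ?_⟩
    calc |(φ + ψ) τ| ≤ |φ τ| + |ψ τ| := abs_add_le _ _
      _ ≤ C * euclideanNorm τ + D * euclideanNorm τ := add_le_add (hφ τ) (hψ τ)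
      _ = _ := by ring
  · rintro c φ ⟨C, hC, hφ⟩
    refine ⟨|c| * C, by positivity, fun τ => ?_⟩
    rw [LinearMap.smul_apply, smul_eq_mul, abs_mul, mul_assoc]
    exact mul_le_mul_of_nonneg_left (hφ τ) (abs_nonneg c)

/-- A linear map from tensors on `ℝⁿ` to operators is bounded for the Euclidean norm. -/
theorem MixedTensor.exists_operator_bound {n : ℕ} {U : Type*} [NormedAddCommGroup U]
    [NormedSpace ℝ U] [FiniteDimensional ℝ U]
    (L : MixedTensor r s (Model n) →ₗ[ℝ] U) :
    ∃ C, 0 ≤ C ∧ ∀ τ, ‖L τ‖ ≤ C * euclideanNorm τ := by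
  let b := Module.finBasis ℝ U
  choose C hC hL using fun i => MixedTensor.exists_dual_bound ((b.coord i) ∘ₗ L)
  refine ⟨∑ i, C i * ‖b i‖, Finset.sum_nonneg fun i _ => mul_nonneg (hC i) (norm_nonneg _), ?_⟩
  intro τ
  rw [← b.sum_repr (L τ), Finset.sum_mul]
  refine norm_sum_le_of_le _ fun i _ => ?_
  rw [norm_smul]
  calc ‖(b.repr (L τ)) i‖ * ‖b i‖ ≤ (C i * euclideanNorm τ) * ‖b i‖ :=
        mul_le_mul_of_nonneg_right (hL i τ) (norm_nonneg _)
    _ = _ := by ring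

end TensorAlgebra

/-! ### The transported complements and the uniqueness of the operator `Q`. -/

section Complement

variable {N : ℕ} {r s : Fin N → ℕ} {n : ℕ}
variable {V : Type*} [AddCommGroup V] [Module ℝ V] {W : Type*} [AddCommGroup W] [Module ℝ W]
variable {γ₀ : MixedTensor r s (Model n)} {𝔮 : Submodule ℝ (Module.End ℝ (Model n))}

/-- Two isomorphisms that pull `γ₀` back to the same tensor differ by an element of the stabilizer,
and conjugation by it preserves `𝔮`. -/
theorem mem_complementAt_pull_iff (h𝔮 : IsInvariantComplement γ₀ 𝔮) (e : V ≃ₗ[ℝ] Model n)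
    {A : Module.End ℝ V} :
    A ∈ complementAt γ₀ 𝔮 (MixedTensor.pull e γ₀) ↔ e.conj A ∈ 𝔮 := by
  refine ⟨?_, fun h => ⟨e, rfl, h⟩⟩
  rintro ⟨f, hf, hA⟩
  have h1 : MixedTensor.pull (f.symm.trans e) γ₀ = γ₀ := by
    rw [← MixedTensor.pull_pull, hf, MixedTensor.pull_symm_pull]
  have h2 := h𝔮.conj_mem _ h1 _ hA
  convert h2 using 1
  ext x
  simp [LinearEquiv.conj_apply]

theorem conj_mem_complementAt (h : V ≃ₗ[ℝ] W) {σ : MixedTensor r s W} {A : Module.End ℝ V}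
    (hA : A ∈ complementAt γ₀ 𝔮 (MixedTensor.pull h σ)) : h.conj A ∈ complementAt γ₀ 𝔮 σ := by
  obtain ⟨e, he, hA⟩ := hA
  refine ⟨h.symm.trans e, ?_, ?_⟩
  · rw [← MixedTensor.pull_pull, ← he, MixedTensor.pull_symm_pull]
  · convert hA using 1
    ext x
    simp [LinearEquiv.conj_apply]

/-- Conjugated to the model, `A - B` lies both in `𝔮` and in the stabilizer algebra. -/
theorem complementAt_injOn (h𝔮 : IsInvariantComplement γ₀ 𝔮) {σ : MixedTensor r s V}
    {A B : Module.End ℝ V} (hA : A ∈ complementAt γ₀ 𝔮 σ) (hB : B ∈ complementAt γ₀ 𝔮 σ)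
    (hAB : MixedTensor.theta σ A = MixedTensor.theta σ B) : A = B := by
  obtain ⟨e, rfl, hA⟩ := hA
  rw [mem_complementAt_pull_iff h𝔮] at hB
  have h1 : e.conj (A - B) ∈ 𝔮 := by
    rw [map_sub]; exact 𝔮.sub_mem hA hB
  have h2 : e.conj (A - B) ∈ MixedTensor.stabilizerAlgebra γ₀ := by
    rw [MixedTensor.stabilizerAlgebra, LinearMap.mem_ker, ← MixedTensor.pull_symm_theta_pull,
      map_sub, hAB]
    exact congrArg (MixedTensor.pull e.symm) (sub_self (G := MixedTensor r s V) _)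
  have h3 := (Submodule.disjoint_def.mp h𝔮.isCompl.disjoint) _ h2 h1
  rw [← sub_eq_zero]
  exact e.conj.map_eq_zero_iff.mp h3

/-- Discarding the stabilizer component of an operator does not change its infinitesimal action. -/
theorem exists_mem_complementAt (h𝔮 : IsInvariantComplement γ₀ 𝔮) (e : V ≃ₗ[ℝ] Model n)
    {τ : MixedTensor r s V}
    (hτ : τ ∈ LinearMap.range (MixedTensor.theta (MixedTensor.pull e γ₀))) :
    ∃ A ∈ complementAt γ₀ 𝔮 (MixedTensor.pull e γ₀),
      MixedTensor.theta (MixedTensor.pull e γ₀) A = τ := by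
  obtain ⟨A, rfl⟩ := hτ
  obtain ⟨B, C, hB, hC, hBC⟩ := Submodule.codisjoint_iff_exists_add_eq.mp
    h𝔮.isCompl.codisjoint (e.conj A)
  refine ⟨e.symm.conj C, ⟨e, rfl, ?_⟩, ?_⟩
  · rw [LinearEquiv.conj_conj_symm]; exact hC
  · rw [← MixedTensor.pull_theta, ← MixedTensor.pull_pull_symm e
      (MixedTensor.theta (MixedTensor.pull e γ₀) A), MixedTensor.pull_symm_theta_pull, ← hBC,
      map_add, LinearMap.mem_ker.mp hB, zero_add]

/-- A linear section of the infinitesimal action with values in the complement. -/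
theorem exists_section_theta [FiniteDimensional ℝ V] (h𝔮 : IsInvariantComplement γ₀ 𝔮)
    (e : V ≃ₗ[ℝ] Model n) :
    ∃ L : MixedTensor r s V →ₗ[ℝ] Module.End ℝ V, ∀ A ∈ complementAt γ₀ 𝔮 (MixedTensor.pull e γ₀),
      L (MixedTensor.theta (MixedTensor.pull e γ₀) A) = A := by
  let S : Submodule ℝ (Module.End ℝ V) := 𝔮.comap e.conj.toLinearMap
  have hS : ∀ A, A ∈ S ↔ A ∈ complementAt γ₀ 𝔮 (MixedTensor.pull e γ₀) := fun A =>
    (mem_complementAt_pull_iff h𝔮 e).symm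
  obtain ⟨L, hL⟩ := LinearMap.exists_leftInverse_of_injective (V' := MixedTensor r s V)
    (MixedTensor.theta (MixedTensor.pull e γ₀) ∘ₗ S.subtype) (by
      refine (LinearMap.ker_eq_bot (M₂ := MixedTensor r s V)).mpr ?_
      rintro ⟨A, hA⟩ ⟨B, hB⟩ hAB
      exact Subtype.ext (complementAt_injOn h𝔮 ((hS A).mp hA) ((hS B).mp hB) hAB))
  refine ⟨S.subtype ∘ₗ L, fun A hA => ?_⟩
  have := LinearMap.congr_fun hL ⟨A, (hS A).mpr hA⟩
  exact congrArg Subtype.val this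

end Complement

end HomogeneousFlow

end

noncomputable section

namespace HomogeneousFlow

/-! ### Differentiating multilinear maps whose arguments vary. -/

section MultilinearCalculus

variable {D : Type*} [AddCommGroup D] [Module ℝ D]

/-- Splits off the first argument through its coordinates; this drives the inductions on the number
of arguments below. -/
theorem multilinear_apply_eq_sum_coord {ι : Type*} [Fintype ι] (b : Module.Basis ι ℝ D) {d : ℕ}
    (T : MultilinearMap ℝ (fun _ : Fin (d + 1) => D) ℝ) (β : Fin (d + 1) → D) :
    T β = ∑ i, b.coord i (β 0) * T (Fin.cons (b i) (Fin.tail β)) := by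
  have h := congrArg (fun S : MultilinearMap ℝ (fun _ : Fin d => D) ℝ => S (Fin.tail β))
    (congrArg T.curryLeft (b.sum_repr (β 0)))
  simp only [map_sum, map_smul, sum_apply, smul_apply, smul_eq_mul,
    MultilinearMap.curryLeft_apply, Fin.cons_self_tail] at h
  exact h.symm

/-- Evaluation of multilinear maps at fixed arguments, as a linear map. -/
def evalₗ {d : ℕ} (α : Fin d → D) : MultilinearMap ℝ (fun _ : Fin d => D) ℝ →ₗ[ℝ] ℝ where
  toFun T := T α
  map_add' _ _ := rfl
  map_smul' _ _ := rfl

/-- If multilinear maps and their arguments depend smoothly on a point, then so do the values. -/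
theorem contMDiffAt_multilinear_apply [FiniteDimensional ℝ D] {E : Type*} [NormedAddCommGroup E] [NormedSpace ℝ E]
    {H : Type*} [TopologicalSpace H] {I : ModelWithCorners ℝ E H} {X : Type*} [TopologicalSpace X]
    [ChartedSpace H X] {x₀ : X} {d : ℕ}
    {T : X → MultilinearMap ℝ (fun _ : Fin d => D) ℝ} {β : X → Fin d → D}
    (hT : ∀ α, ContMDiffAt I 𝓘(ℝ, ℝ) ∞ (fun x => T x α) x₀)
    (hβ : ∀ j (φ : Module.Dual ℝ D), ContMDiffAt I 𝓘(ℝ, ℝ) ∞ (fun x => φ (β x j)) x₀) :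
    ContMDiffAt I 𝓘(ℝ, ℝ) ∞ (fun x => T x (β x)) x₀ := by
  induction d with
  | zero =>
    convert hT Fin.elim0 using 3
  | succ d ih =>
    let b := Module.finBasis ℝ D
    rw [funext fun x => multilinear_apply_eq_sum_coord b (T x) (β x)]
    refine contMDiffAt_finsetSum fun i _ => (hβ 0 (b.coord i)).mul ?_
    exact ih (T := fun x => (T x).curryLeft (b i)) (β := fun x => Fin.tail (β x))
      (fun α => hT _) (fun j φ => hβ j.succ φ)

/-- The product rule for multilinear maps. -/
theorem hasDerivAt_multilinear_apply [FiniteDimensional ℝ D] {t : ℝ} {d : ℕ}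
    {T : ℝ → MultilinearMap ℝ (fun _ : Fin d => D) ℝ}
    {T' : MultilinearMap ℝ (fun _ : Fin d => D) ℝ} {β : ℝ → Fin d → D} {β' : Fin d → D}
    (hT : ∀ α, HasDerivAt (fun x => T x α) (T' α) t)
    (hβ : ∀ j (φ : Module.Dual ℝ D), HasDerivAt (fun x => φ (β x j)) (φ (β' j)) t) :
    HasDerivAt (fun x => T x (β x))
      (T' (β t) + ∑ j, T t (Function.update (β t) j (β' j))) t := by
  induction d with
  | zero =>
    convert hT Fin.elim0 using 1
    · funext x
      congr 1
      exact Subsingleton.elim _ _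
    · simp only [Finset.univ_eq_empty, Finset.sum_empty, add_zero]
      congr 1
      exact Subsingleton.elim _ _
  | succ d ih =>
    let b := Module.finBasis ℝ D
    have h1 : ∀ i, HasDerivAt (fun x => T x (Fin.cons (b i) (Fin.tail (β x))))
        (T' (Fin.cons (b i) (Fin.tail (β t))) + ∑ j, T t (Fin.cons (b i)
          (Function.update (Fin.tail (β t)) j (Fin.tail β' j)))) t := fun i =>
      ih (T := fun x => (T x).curryLeft (b i)) (T' := T'.curryLeft (b i))
        (β := fun x => Fin.tail (β x)) (β' := Fin.tail β')
        (fun α => hT _) (fun j φ => hβ j.succ φ)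
    have h2 := HasDerivAt.fun_sum (u := Finset.univ)
      fun i _ => (hβ 0 (b.coord i)).fun_mul (h1 i)
    rw [funext fun x => (multilinear_apply_eq_sum_coord b (T x) (β x)).symm] at h2
    refine h2.congr_deriv ?_
    -- The derivatives of the coordinates of the first argument make up the term `j = 0`; the
    -- inductive hypothesis gives the others. All terms are expanded in the basis and compared.
    rw [multilinear_apply_eq_sum_coord b T', Fin.sum_univ_succ]
    rw [multilinear_apply_eq_sum_coord b (T t)]
    simp_rw [multilinear_apply_eq_sum_coord b (T t) (Function.update (β t) (Fin.succ _) _)]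
    rw [Finset.sum_comm (f := fun (x : Fin d) i => _), ← Finset.sum_add_distrib,
      ← Finset.sum_add_distrib]
    refine Finset.sum_congr rfl fun i _ => ?_
    have e1 : Fin.tail (Function.update (β t) 0 (β' 0)) = Fin.tail (β t) := Fin.tail_update_zero _ _
    have e2 : ∀ j : Fin d, Fin.tail (Function.update (β t) j.succ (β' j.succ))
      = Function.update (Fin.tail (β t)) j (Fin.tail β' j) := fun j => Fin.tail_update_succ _ _ _
    simp only [e1, e2, Function.update_self, Function.update_of_ne (Fin.succ_ne_zero _).symm]
    rw [← Finset.mul_sum]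
    ring

end MultilinearCalculus

/-! ### Smoothness and the product rule for moved tensors. -/

section TensorCalculus

variable {N : ℕ} {r s : Fin N → ℕ}
variable {V : Type*} [AddCommGroup V] [Module ℝ V]
  {W : Type*} [AddCommGroup W] [Module ℝ W] [FiniteDimensional ℝ W]

theorem exists_eval_eq_dual_dual (φ : Module.Dual ℝ (Module.Dual ℝ W)) :
    ∃ v : W, ∀ f, φ f = f v := by
  obtain ⟨v, rfl⟩ := (Module.evalEquiv ℝ W).surjective φ
  exact ⟨v, fun f => rfl⟩

theorem contMDiffAt_comap {E : Type*} [NormedAddCommGroup E] [NormedSpace ℝ E]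
    {H : Type*} [TopologicalSpace H] {I : ModelWithCorners ℝ E H} {X : Type*} [TopologicalSpace X]
    [ChartedSpace H X] {x₀ : X} {A : X → V →ₗ[ℝ] W} {B : X → W →ₗ[ℝ] V}
    {τ : X → MixedTensor r s W}
    (hA : ∀ v (φ : Module.Dual ℝ W), ContMDiffAt I 𝓘(ℝ, ℝ) ∞ (fun x => φ (A x v)) x₀)
    (hB : ∀ w (φ : Module.Dual ℝ V), ContMDiffAt I 𝓘(ℝ, ℝ) ∞ (fun x => φ (B x w)) x₀)
    (hτ : ∀ k v α, ContMDiffAt I 𝓘(ℝ, ℝ) ∞ (fun x => τ x k v α) x₀) (k v α) :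
    ContMDiffAt I 𝓘(ℝ, ℝ) ∞ (fun x => MixedTensor.comap (A x) (B x) (τ x) k v α) x₀ := by
  simp_rw [MixedTensor.comap_apply]
  refine contMDiffAt_multilinear_apply (T := fun x => τ x k fun i => A x (v i))
    (β := fun x j => α j ∘ₗ B x) (fun α' => ?_) (fun j φ => ?_)
  · exact contMDiffAt_multilinear_apply
      (T := fun x => (evalₗ α').compMultilinearMap (τ x k))
      (β := fun x i => A x (v i)) (fun v' => hτ k v' α') (fun i φ => hA _ φ)
  · obtain ⟨w, hw⟩ := exists_eval_eq_dual_dual φ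
    simp_rw [hw]
    exact hB w (α j)

/-- The product rule, first in the vector slots with covectors fixed, then in the covector slots.
`A` and `B` vary independently; in the applications they are mutually inverse. -/
theorem hasDerivAt_comap {t : ℝ} {A : ℝ → V →ₗ[ℝ] W} {A' : V →ₗ[ℝ] W} {B : ℝ → W →ₗ[ℝ] V}
    {B' : W →ₗ[ℝ] V} {τ : ℝ → MixedTensor r s W} {τ' : MixedTensor r s W}
    (hA : ∀ v (φ : Module.Dual ℝ W), HasDerivAt (fun x => φ (A x v)) (φ (A' v)) t)
    (hB : ∀ w (φ : Module.Dual ℝ V), HasDerivAt (fun x => φ (B x w)) (φ (B' w)) t)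
    (hτ : ∀ k v α, HasDerivAt (fun x => τ x k v α) (τ' k v α) t) (k v α) :
    HasDerivAt (fun x => MixedTensor.comap (A x) (B x) (τ x) k v α)
      (MixedTensor.comap (A t) (B t) τ' k v α
        + ∑ i, τ t k (Function.update (fun i => A t (v i)) i (A' (v i))) (fun j => α j ∘ₗ B t)
        + ∑ j, τ t k (fun i => A t (v i))
            (Function.update (fun j => α j ∘ₗ B t) j (α j ∘ₗ B'))) t := by
  have h1 : ∀ α' : Fin (s k) → Module.Dual ℝ W, HasDerivAt (fun x => τ x k (fun i => A x (v i)) α')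
      (τ' k (fun i => A t (v i)) α'
        + ∑ i, τ t k (Function.update (fun i => A t (v i)) i (A' (v i))) α') t := fun α' =>
    hasDerivAt_multilinear_apply
      (T := fun x => (evalₗ α').compMultilinearMap (τ x k))
      (T' := (evalₗ α').compMultilinearMap (τ' k))
      (β := fun x i => A x (v i)) (β' := fun i => A' (v i))
      (fun v' => hτ k v' α') (fun i φ => hA _ φ)
  have h2 := hasDerivAt_multilinear_apply (T := fun x => τ x k fun i => A x (v i))
    (T' := τ' k (fun i => A t (v i))
      + ∑ i, τ t k (Function.update (fun i => A t (v i)) i (A' (v i))))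
    (β := fun x j => α j ∘ₗ B x) (β' := fun j => α j ∘ₗ B')
    (fun α' => by simpa using h1 α')
    (fun j φ => by
      obtain ⟨w, hw⟩ := exists_eval_eq_dual_dual φ
      simp_rw [hw]
      exact hB w (α j))
  simpa [MixedTensor.comap_apply] using h2

end TensorCalculus

end HomogeneousFlow

end

noncomputable section

namespace HomogeneousFlow

/-! ### Local right inverses of submersions. -/

section Submersion

variable {m n : ℕ} {G : Type*} [TopologicalSpace G] [ChartedSpace (Model m) G]
  {M : Type*} [TopologicalSpace M] [ChartedSpace (Model n) M]
  [IsManifold (𝓡 m) ∞ G]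

open scoped Topology in
/-- A map of vector spaces that is a submersion at a point has a smooth local right inverse. -/
theorem exists_local_rightInverse {E F : Type*} [NormedAddCommGroup E] [NormedSpace ℝ E]
    [NormedAddCommGroup F] [NormedSpace ℝ F] [FiniteDimensional ℝ F]
    {f : E → F} {a : E} (hf : ContDiffAt ℝ ∞ f a)
    (hsurj : Function.Surjective (fderiv ℝ f a)) :
    ∃ g : F → E, ContDiffAt ℝ ∞ g (f a) ∧ g (f a) = a ∧ ∀ᶠ y in 𝓝 (f a), f (g y) = y := by
  have : CompleteSpace F := FiniteDimensional.complete ℝ F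
  obtain ⟨B₀, hB₀⟩ := LinearMap.exists_rightInverse_of_surjective (fderiv ℝ f a : E →ₗ[ℝ] F)
    (LinearMap.range_eq_top.mpr hsurj)
  let B : F →L[ℝ] E := LinearMap.toContinuousLinearMap B₀
  have hB : ∀ v, fderiv ℝ f a (B v) = v := fun v => LinearMap.congr_fun hB₀ v
  -- Restricting `f` to the slice `a + B F`, with `B` a right inverse of the differential, gives a
  -- map with identity differential at `0`, to which the inverse function theorem applies.
  let k : F → F := fun y => f (a + B y)
  have h0 : a + B 0 = a := by simp
  have hk : ContDiffAt ℝ ∞ k 0 := by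
    refine ContDiffAt.comp (0 : F) (g := f) (f := fun y => a + B y) (by rw [h0]; exact hf) ?_
    exact contDiffAt_const.add B.contDiff.contDiffAt
  have hk' : HasFDerivAt k ((ContinuousLinearEquiv.refl ℝ F : F ≃L[ℝ] F) : F →L[ℝ] F) 0 := by
    have h1 : HasFDerivAt f (fderiv ℝ f a) (a + B 0) := by
      rw [h0]; exact (hf.differentiableAt (by simp)).hasFDerivAt
    have h2 := h1.comp (0 : F) ((B.hasFDerivAt (x := 0)).const_add a)
    refine h2.congr_fderiv ?_
    ext v
    exact hB v
  have hk0 : k 0 = f a := by simp [k]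
  let l := hk.localInverse hk' (by simp)
  have hl : ContDiffAt ℝ ∞ l (f a) := hk0 ▸ hk.to_localInverse hk' (by simp)
  have hl0 : l (f a) = 0 := hk0 ▸ hk.localInverse_apply_image hk' (by simp)
  refine ⟨fun y => a + B (l y), contDiffAt_const.add (B.contDiff.contDiffAt.comp _ hl), ?_, ?_⟩
  · simp [hl0]
  · have := (hk.hasStrictFDerivAt' hk' (by simp)).eventually_right_inverse
    rw [hk0] at this
    exact this

open scoped Topology in
/-- A smooth map that is a submersion at a point has a smooth local right inverse. -/
theorem exists_local_rightInverse_of_mfderiv {f : G → M} {a : G} (hf : ContMDiffAt (𝓡 m) (𝓡 n) ∞ f a)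
    (hsurj : Function.Surjective (mfderiv (𝓡 m) (𝓡 n) f a)) :
    ∃ g : M → G, ContMDiffAt (𝓡 n) (𝓡 m) ∞ g (f a) ∧ ∀ᶠ y in 𝓝 (f a), f (g y) = y := by
  set φ := extChartAt (𝓡 m) a
  set ψ := extChartAt (𝓡 n) (f a)
  let F : Model m → Model n := writtenInExtChartAt (𝓡 m) (𝓡 n) a f
  have hF : ContDiffAt ℝ ∞ F (φ a) := by
    have := (contMDiffAt_iff.mp hf).2
    rwa [ModelWithCorners.range_eq_univ, contDiffWithinAt_univ] at this
  have hF' : Function.Surjective (fderiv ℝ F (φ a)) := by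
    rw [(hf.mdifferentiableAt (by simp)).mfderiv] at hsurj
    rwa [ModelWithCorners.range_eq_univ, fderivWithin_univ] at hsurj
  obtain ⟨k, hk, hka, hFk⟩ := exists_local_rightInverse hF hF'
  have hFa : F (φ a) = ψ (f a) := by simp [F, φ, ψ, writtenInExtChartAt]
  rw [hFa] at hk hka hFk
  let g : M → G := fun y => φ.symm (k (ψ y))
  have hψ : ContMDiffAt (𝓡 n) 𝓘(ℝ, Model n) ∞ ψ (f a) := contMDiffAt_extChartAt
  have hg : ContMDiffAt (𝓡 n) (𝓡 m) ∞ g (f a) := by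
    have h1 : ContMDiffAt 𝓘(ℝ, Model m) (𝓡 m) ∞ φ.symm (k (ψ (f a))) := by
      rw [hka]
      exact (contMDiffOn_extChartAt_symm a).contMDiffAt (extChartAt_target_mem_nhds a)
    exact h1.comp (f a) (hk.contMDiffAt.comp (f a) hψ)
  have hga : g (f a) = a := by
    simp only [g, hka]
    exact extChartAt_to_inv a
  refine ⟨g, hg, ?_⟩
  have hc : ContinuousAt (fun y => f (g y)) (f a) :=
    ContinuousAt.comp (by rw [hga]; exact hf.continuousAt) hg.continuousAt
  -- The identity is known only in the chart `ψ`; it descends by injectivity once both points lie in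
  -- the chart domain.
  have e1 : ∀ᶠ y in 𝓝 (f a), f (g y) ∈ ψ.source :=
    hc.eventually_mem (by rw [hga]; exact extChartAt_source_mem_nhds _)
  have e2 : ∀ᶠ y in 𝓝 (f a), y ∈ ψ.source := extChartAt_source_mem_nhds _
  filter_upwards [e1, e2, hψ.continuousAt.eventually hFk] with y h1 h2 h3
  exact ψ.injOn h1 h2 h3

end Submersion

/-! ### Differentials of the action and invariant tensor fields. -/

section Action

variable {N : ℕ} {r s : Fin N → ℕ} {m n : ℕ}
  {G : Type*} [TopologicalSpace G] [ChartedSpace (Model m) G] [Group G] [LieGroup (𝓡 m) ∞ G]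
  {M : Type*} [TopologicalSpace M] [ChartedSpace (Model n) M] [IsManifold (𝓡 n) ∞ M]
  [MulAction G M] [ContMDiffSMul (𝓡 m) (𝓡 n) ∞ G M]

variable (m n) in
/-- The differential at `x` of the action of `g`, as an operator on the model space. -/
def actionDeriv (g : G) (x : M) : Model n ≃ₗ[ℝ] Model n :=
  ((actionDiffeo (m := m) (n := n) g).mfderivToContinuousLinearEquiv (by simp) x).toLinearEquiv

omit [LieGroup (𝓡 m) ∞ G] [IsManifold (𝓡 n) ∞ M] in
theorem actionDeriv_apply (g : G) (x : M) (v : Model n) :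
    actionDeriv m n g x v = mfderiv (𝓡 n) (𝓡 n) (fun y : M => g • y) x v := rfl

omit [LieGroup (𝓡 m) ∞ G] [IsManifold (𝓡 n) ∞ M] in
theorem actionDeriv_mul (g h : G) (x : M) :
    actionDeriv m n (g * h) x = (actionDeriv m n h x).trans (actionDeriv m n g (h • x)) := by
  ext1 v
  have hd : ∀ (g : G) (x : M), MDifferentiableAt (𝓡 n) (𝓡 n) (fun y : M => g • y) x := fun g x =>
    ((actionDiffeo (m := m) (n := n) g).contMDiff_toFun x).mdifferentiableAt (by simp)
  rw [actionDeriv_apply, LinearEquiv.trans_apply, actionDeriv_apply, actionDeriv_apply]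
  have h1 : (fun y : M => (g * h) • y) = (fun y : M => g • y) ∘ fun y => h • y := by
    funext y; exact mul_smul g h y
  rw [h1, mfderiv_comp x (hd g _) (hd h x)]
  rfl

omit [LieGroup (𝓡 m) ∞ G] [IsManifold (𝓡 n) ∞ M] in
theorem actionDeriv_one (x : M) : actionDeriv m n (1 : G) x = LinearEquiv.refl ℝ _ := by
  ext1 v
  rw [actionDeriv_apply]
  have h1 : (fun y : M => (1 : G) • y) = id := by
    funext y; exact one_smul G y
  rw [h1, mfderiv_id]
  rfl

omit [LieGroup (𝓡 m) ∞ G] [IsManifold (𝓡 n) ∞ M] in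
-- Expressing the inverse as the differential of `g⁻¹` makes its smoothness an instance of
-- `contMDiffAt_actionDeriv`.
theorem actionDeriv_symm (g : G) (x : M) :
    (actionDeriv m n g x).symm = actionDeriv m n g⁻¹ (g • x) := by
  have h := actionDeriv_mul (m := m) (n := n) g⁻¹ g x
  rw [inv_mul_cancel, actionDeriv_one] at h
  ext1 v
  rw [LinearEquiv.symm_apply_eq]
  apply (actionDeriv m n g⁻¹ (g • x)).injective
  have := LinearEquiv.congr_fun h (actionDeriv m n g⁻¹ (g • x) v)
  exact this

omit [LieGroup (𝓡 m) ∞ G] [IsManifold (𝓡 n) ∞ M] in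
theorem IsInvariant.pull_actionDeriv {τ : TensorField n r s M} (hτ : IsInvariant (m := m) G τ)
    (g : G) (x : M) :
    MixedTensor.pull (actionDeriv m n g x) (τ (g • x) : MixedTensor r s (Model n)) = τ x :=
  congrFun (hτ g) x

/-- The tensor field with value `σ` at `o` that is moved around by the group elements `sec x`. -/
def invariantField (o : M) (sec : M → G) (σ : MixedTensor r s (Model n)) : TensorField n r s M :=
  fun x => MixedTensor.pull (actionDeriv m n (sec x) o).symm σ

variable {o : M} {sec : M → G} {σ : MixedTensor r s (Model n)}

omit [LieGroup (𝓡 m) ∞ G] [IsManifold (𝓡 n) ∞ M] in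
theorem IsInvariant.eq_of_apply_eq {τ τ' : TensorField n r s M} (hsec : ∀ x, sec x • o = x)
    (hτ : IsInvariant (m := m) G τ) (hτ' : IsInvariant (m := m) G τ') (h : τ o = τ' o) :
    τ = τ' := by
  funext x
  have h1 := hτ.pull_actionDeriv (sec x)⁻¹ x
  have h2 := hτ'.pull_actionDeriv (sec x)⁻¹ x
  have h3 : (sec x)⁻¹ • x = o := by rw [inv_smul_eq_iff, hsec]
  rw [h3] at h1 h2
  rw [← h1, ← h2, h]

omit [LieGroup (𝓡 m) ∞ G] [IsManifold (𝓡 n) ∞ M] in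
-- The elements `sec (g • o)` and `g` differ by an isotropy element, which fixes `σ`. Hence the
-- field does not depend on `sec`, of which no continuity is required.
theorem invariantField_smul (hsec : ∀ x, sec x • o = x)
    (hσ : ∀ g : G, g • o = o → MixedTensor.pull (actionDeriv m n g o) σ = σ) (g : G) :
    invariantField (m := m) o sec σ (g • o) = MixedTensor.pull (actionDeriv m n g o).symm σ := by
  have hk : (g⁻¹ * sec (g • o)) • o = o := by
    rw [mul_smul, hsec, inv_smul_smul]
  have h1 := actionDeriv_mul (m := m) (n := n) g (g⁻¹ * sec (g • o)) o
  rw [mul_inv_cancel_left, hk] at h1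
  have h2 := hσ _ hk
  have h3 : invariantField (m := m) o sec σ (g • o)
      = MixedTensor.pull (actionDeriv m n g o).symm
        (MixedTensor.pull (actionDeriv m n (g⁻¹ * sec (g • o)) o).symm σ) := by
    rw [MixedTensor.pull_pull, ← LinearEquiv.trans_symm, ← h1]
    rfl
  rw [h3]
  conv_lhs => rw [← h2]
  rw [MixedTensor.pull_symm_pull]

omit [LieGroup (𝓡 m) ∞ G] [IsManifold (𝓡 n) ∞ M] in
theorem invariantField_apply_self (hsec : ∀ x, sec x • o = x)
    (hσ : ∀ g : G, g • o = o → MixedTensor.pull (actionDeriv m n g o) σ = σ) :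
    invariantField (m := m) o sec σ o = σ := by
  have h := invariantField_smul (m := m) hsec hσ 1
  rw [one_smul, actionDeriv_one] at h
  exact h

omit [LieGroup (𝓡 m) ∞ G] [IsManifold (𝓡 n) ∞ M] in
theorem isInvariant_invariantField (hsec : ∀ x, sec x • o = x)
    (hσ : ∀ g : G, g • o = o → MixedTensor.pull (actionDeriv m n g o) σ = σ) :
    IsInvariant (m := m) G (invariantField (m := m) o sec σ) := by
  intro g
  funext x
  show MixedTensor.pull (actionDeriv m n g x) (invariantField (m := m) o sec σ (g • x))
    = invariantField (m := m) o sec σ x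
  rw [← hsec x, invariantField_smul hsec hσ, ← mul_smul, invariantField_smul hsec hσ,
    actionDeriv_mul, LinearEquiv.trans_symm, ← MixedTensor.pull_pull, MixedTensor.pull_pull_symm]

open scoped Topology in
omit [IsManifold (𝓡 n) ∞ M] in
-- The submersion property at the identity gives a section near `o`, and translation by `g` carries
-- it to a neighbourhood of `g • o`.
theorem IsHomogeneousSpace.exists_local_section (hM : IsHomogeneousSpace (m := m) (n := n) G o)
    (x₀ : M) : ∃ c : M → G, ContMDiffAt (𝓡 n) (𝓡 m) ∞ c x₀ ∧ ∀ᶠ x in 𝓝 x₀, c x • o = x := by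
  have := hM.transitive
  obtain ⟨g, rfl⟩ := MulAction.exists_smul_eq G o x₀
  have hf : ContMDiff (𝓡 m) (𝓡 n) ∞ (fun g : G => g • o) :=
    (contMDiff_smul (I := 𝓡 m) (I' := 𝓡 n) (G := G) (M := M)).comp
      (contMDiff_id.prodMk contMDiff_const)
  obtain ⟨c, hc, hco⟩ := exists_local_rightInverse_of_mfderiv (hf 1) hM.submersion
  rw [one_smul] at hc hco
  have hg : ContMDiff (𝓡 n) (𝓡 n) ∞ (fun x : M => g⁻¹ • x) :=
    (actionDiffeo (m := m) (n := n) g⁻¹).contMDiff_toFun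
  have hgo : g⁻¹ • g • o = o := inv_smul_smul g o
  refine ⟨fun x => g * c (g⁻¹ • x), ?_, ?_⟩
  · refine ContMDiffAt.mul contMDiffAt_const ?_
    exact ContMDiffAt.comp (g • o) (g := c) (f := fun x : M => g⁻¹ • x) (by rw [hgo]; exact hc)
      (hg _)
  · have h1 := (hg.continuous.continuousAt (x := g • o)).eventually (p := fun y => c y • o = y)
      (by simpa only [hgo] using hco)
    filter_upwards [h1] with x hx
    rw [mul_smul, hx, smul_inv_smul]

section Coordinates

omit [Group G] [LieGroup (𝓡 m) ∞ G] [MulAction G M] [ContMDiffSMul (𝓡 m) (𝓡 n) ∞ G M]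

variable (n) in
/-- The trivialization of the tangent bundle near `a`, at `b`, as an operator on the model. -/
def tangentCoord (a b : M) : Model n →ₗ[ℝ] Model n :=
  (trivializationAt (Model n) (TangentSpace (𝓡 n)) a).linearMapAt ℝ b

variable (n) in
/-- The inverse trivialization of the tangent bundle near `a`, at `b`. -/
def tangentCoordSymm (a b : M) : Model n →ₗ[ℝ] Model n :=
  (trivializationAt (Model n) (TangentSpace (𝓡 n)) a).symmₗ ℝ b

theorem tangentCoordSymm_tangentCoord (a : M) (v : Model n) :
    tangentCoordSymm n a a (tangentCoord n a a v) = v :=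
  (trivializationAt (Model n) (TangentSpace (𝓡 n)) a).symmₗ_linearMapAt
    (mem_baseSet_trivializationAt _ _ _) v

end Coordinates

omit [LieGroup (𝓡 m) ∞ G] in
/-- The differentials of smoothly varying group elements depend smoothly on the parameter. -/
theorem contMDiffAt_actionDeriv {c : M → G} {f : M → M} {x₀ : M}
    (hc : ContMDiffAt (𝓡 n) (𝓡 m) ∞ c x₀) (hf : ContMDiffAt (𝓡 n) (𝓡 n) ∞ f x₀) (v : Model n)
    (φ : Module.Dual ℝ (Model n)) :
    ContMDiffAt (𝓡 n) 𝓘(ℝ, ℝ) ∞ (fun x => φ (tangentCoord n (c x₀ • f x₀) (c x • f x)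
      (actionDeriv m n (c x) (f x) (tangentCoordSymm n (f x₀) (f x) v)))) x₀ := by
  have : IsManifold (𝓡 n) 1 M := .of_le (n := ∞) (by simp)
  have hsmul := contMDiff_smul (I := 𝓡 m) (I' := 𝓡 n) (n := ∞) (G := G) (M := M)
  have h1 : ContMDiffAt (𝓡 n) 𝓘(ℝ, Model n →L[ℝ] Model n) ∞ (inTangentCoordinates (𝓡 n) (𝓡 n)
      f (fun x => c x • f x)
      (fun x => mfderiv (𝓡 n) (𝓡 n) (fun y : M => c x • y) (f x)) x₀) x₀ := by
    refine ContMDiffAt.mfderiv (fun x y => c x • y) f (n := ∞) ?_ hf (by simp)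
    exact hsmul.contMDiffAt.comp (x₀, f x₀)
      ((hc.comp (x₀, f x₀) contMDiffAt_fst).prodMk contMDiffAt_snd)
  exact ((LinearMap.toContinuousLinearMap φ).contMDiff.contMDiffAt).comp x₀
    (h1.clm_apply (contMDiffAt_const (c := v)))

open scoped Topology in
-- By `invariantField_smul`, a smooth local section `c` may replace `sec` near `x₀`; the field is
-- then the constant tensor `σ` moved by smoothly varying differentials.
theorem isSmoothField_invariantField (hM : IsHomogeneousSpace (m := m) (n := n) G o)
    (hsec : ∀ x, sec x • o = x)
    (hσ : ∀ g : G, g • o = o → MixedTensor.pull (actionDeriv m n g o) σ = σ) :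
    IsSmoothField (invariantField (m := m) o sec σ) := by
  intro x₀
  obtain ⟨c, hc, hco⟩ := hM.exists_local_section x₀
  have hx₀ : c x₀ • o = x₀ := hco.self_of_nhds
  have hx₀' : (c x₀)⁻¹ • x₀ = o := by rw [inv_smul_eq_iff, hx₀]
  have key := contMDiffAt_comap (I := 𝓡 n) (x₀ := x₀) (τ := fun _ : M => σ)
    (A := fun x => (actionDeriv m n (c x) o).symm.toLinearMap ∘ₗ tangentCoordSymm n x₀ x)
    (B := fun x => tangentCoord n x₀ x ∘ₗ (actionDeriv m n (c x) o).toLinearMap)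
    (fun v φ => ?_) (fun w φ => ?_) (fun _ _ _ => contMDiffAt_const)
  · intro k v α
    refine (key k v α).congr_of_eventuallyEq ?_
    filter_upwards [hco] with x hx
    have h3 := invariantField_smul (m := m) hsec hσ (c x)
    rw [hx] at h3
    rw [h3]
    rfl
  -- The inverse differential is that of `(c x)⁻¹` at `x`. Its target is the constant point `o`,
  -- whose trivialization is undone by `tangentCoordSymm n o o`.
  · refine (contMDiffAt_actionDeriv hc.inv contMDiffAt_id v
      (φ ∘ₗ tangentCoordSymm n o o)).congr_of_eventuallyEq ?_
    filter_upwards [hco] with x hx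
    have hx' : (c x)⁻¹ • x = o := by rw [inv_smul_eq_iff, hx]
    simp only [LinearMap.comp_apply, id_eq, LinearEquiv.coe_coe, hx₀', hx',
      tangentCoordSymm_tangentCoord, actionDeriv_symm, hx]
  · refine (contMDiffAt_actionDeriv hc (contMDiffAt_const (c := o)) (tangentCoord n o o w)
      φ).congr_of_eventuallyEq ?_
    filter_upwards [hco] with x hx
    simp only [LinearMap.comp_apply, LinearEquiv.coe_coe, hx₀, hx, tangentCoordSymm_tangentCoord]

end Action

end HomogeneousFlow

end

noncomputable section

namespace HomogeneousFlow

/-! ### Continuation of integral curves and Gronwall estimates. -/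

section Analysis

open Filter Set
open scoped Topology

theorem mem_timeInterval_coe {a : EReal} {b t : ℝ} :
    t ∈ timeInterval a b ↔ a < (t : EReal) ∧ t < b := by
  simp [timeInterval]

theorem isOpen_timeInterval (a b : EReal) : IsOpen (timeInterval a b) :=
  (isOpen_lt continuous_const continuous_coe_real_ereal).inter
    (isOpen_lt continuous_coe_real_ereal continuous_const)

theorem convex_timeInterval (a b : EReal) : Convex ℝ (timeInterval a b) := by
  rw [convex_iff_ordConnected]
  refine ⟨fun x hx y hy z hz => ⟨?_, ?_⟩⟩
  · exact hx.1.trans_le (EReal.coe_le_coe_iff.mpr hz.1)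
  · exact (EReal.coe_le_coe_iff.mpr hz.2).trans_lt hy.2

/-- An integral curve that converges to a point of the domain extends beyond its end point. -/
theorem exists_extension_of_tendsto {E : Type*} [NormedAddCommGroup E] [NormedSpace ℝ E]
    [CompleteSpace E] {F : E → E} {U : Set E} (hU : IsOpen U) (hF : ContDiffOn ℝ ∞ F U)
    {a : EReal} {T : ℝ} (haT : a < T) {x : ℝ → E}
    (hx : ∀ t ∈ timeInterval a T, x t ∈ U ∧ HasDerivAt x (F (x t)) t) {p : E} (hp : p ∈ U)
    (hlim : Tendsto x (𝓝[<] T) (𝓝 p)) :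
    ∃ b : ℝ, T < b ∧ ∃ y : ℝ → E, (∀ t ∈ timeInterval a b, y t ∈ U ∧ HasDerivAt y (F (y t)) t) ∧
      ∀ t ∈ timeInterval a T, y t = x t := by
  have hFp : ContDiffAt ℝ 1 F p := (hF.contDiffAt (hU.mem_nhds hp)).of_le (by simp)
  obtain ⟨z, hz0, ε, hε, hz⟩ :=
    hFp.exists_forall_mem_closedBall_exists_eq_forall_mem_Ioo_hasDerivAt₀ T
  have hTz : T ∈ Ioo (T - ε) (T + ε) := ⟨by linarith, by linarith⟩
  have hzU : ∀ᶠ t in 𝓝 T, z t ∈ U :=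
    (hz T hTz).continuousAt.eventually_mem (by rw [hz0]; exact hU.mem_nhds hp)
  obtain ⟨η, hη, hzη⟩ := Metric.eventually_nhds_iff.mp hzU
  let y : ℝ → E := fun t => if t < T then x t else z t
  have hy1 : ∀ t, t < T → y t = x t := fun t ht => if_pos ht
  have hy2 : ∀ t, T ≤ t → y t = z t := fun t ht => if_neg ht.not_gt
  refine ⟨T + min ε η, by simp [hε, hη], y, fun t ht => ?_, fun t ht =>
    hy1 t (mem_timeInterval_coe.mp ht).2⟩
  obtain ⟨ht1, ht2⟩ := mem_timeInterval_coe.mp ht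
  rcases lt_trichotomy t T with h | h | h
  · rw [hy1 t h]
    obtain ⟨h1, h2⟩ := hx t (mem_timeInterval_coe.mpr ⟨ht1, h⟩)
    refine ⟨h1, h2.congr_of_eventuallyEq ?_⟩
    filter_upwards [eventually_lt_nhds h] with u hu using hy1 u hu
  · subst h
    rw [hy2 t le_rfl, hz0]
    refine ⟨hp, ?_⟩
    have hr : HasDerivWithinAt y (F p) (Ici t) t := by
      have := (hz t hTz).hasDerivWithinAt (s := Ici t)
      rw [hz0] at this
      exact this.congr (fun u hu => hy2 u hu) (hy2 t le_rfl)
    have hevI : ∀ᶠ u in 𝓝[<] t, u ∈ timeInterval a t := by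
      have : ∀ᶠ u : ℝ in 𝓝 t, a < (u : EReal) :=
        continuous_coe_real_ereal.continuousAt.eventually (lt_mem_nhds haT)
      filter_upwards [this.filter_mono nhdsWithin_le_nhds, self_mem_nhdsWithin] with u h1 h2
      exact mem_timeInterval_coe.mpr ⟨h1, h2⟩
    have hyx : ∀ u ∈ timeInterval a t, HasDerivAt y (F (x u)) u := fun u hu =>
      (hx u hu).2.congr_of_eventuallyEq (by
        filter_upwards [eventually_lt_nhds (mem_timeInterval_coe.mp hu).2] with w hw using hy1 w hw)
    -- At the junction the left derivative exists because `y` is continuous there and its derivative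
    -- `F (x u)` tends to `F p`.
    have hl : HasDerivWithinAt y (F p) (Iic t) t := by
      refine hasDerivWithinAt_Iic_of_tendsto_deriv (s := timeInterval a t) ?_ ?_ hevI ?_
      · exact fun u hu => (hyx u hu).differentiableAt.differentiableWithinAt
      · rw [ContinuousWithinAt, hy2 t le_rfl, hz0]
        have h1 : Tendsto y (𝓝[<] t) (𝓝 p) := hlim.congr' (by
          filter_upwards [self_mem_nhdsWithin] with u hu using (hy1 u hu).symm)
        exact h1.mono_left (nhdsWithin_mono _ fun u hu => (mem_timeInterval_coe.mp hu).2)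
      · have h1 : Tendsto (fun u => F (x u)) (𝓝[<] t) (𝓝 (F p)) := hFp.continuousAt.tendsto.comp hlim
        refine h1.congr' ?_
        filter_upwards [hevI] with u hu using (hyx u hu).deriv.symm
    have := hl.union hr
    rw [Iic_union_Ici] at this
    exact this.hasDerivAt univ_mem
  · have h2 : t < T + ε := ht2.trans_le (by gcongr; exact min_le_left _ _)
    have h3 : t < T + η := ht2.trans_le (by gcongr; exact min_le_right _ _)
    rw [hy2 t h.le]
    refine ⟨hzη (by rw [Real.dist_eq, abs_of_pos] <;> linarith), ?_⟩
    refine (hz t ⟨by linarith, h2⟩).congr_of_eventuallyEq ?_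
    filter_upwards [eventually_gt_nhds h] with u hu using hy2 u hu.le

/-- Growth estimate for a nonnegative function with `|u'| ≤ ρ u`. -/
theorem growth_bounds {T : ℝ} {u u' ρ φ : ℝ → ℝ}
    (hu : ∀ t ∈ Ico 0 T, HasDerivAt u (u' t) t) (hφc : ContinuousOn φ (Ico 0 T))
    (hφ : ∀ t ∈ Ioo 0 T, HasDerivAt φ (ρ t) t)
    (hu' : ∀ t ∈ Ioo 0 T, |u' t| ≤ ρ t * u t) (hφ0 : φ 0 = 0) {t : ℝ} (ht : t ∈ Ico 0 T) :
    u t ≤ Real.exp (φ t) * u 0 ∧ Real.exp (-φ t) * u 0 ≤ u t := by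
  have h0 : (0 : ℝ) ∈ Ico 0 T := ⟨le_rfl, ht.1.trans_lt ht.2⟩
  have huc : ContinuousOn u (Ico 0 T) := fun t ht => (hu t ht).continuousAt.continuousWithinAt
  -- Gronwall in both directions: `u exp(-φ)` decreases and `u exp(φ)` increases.
  have h1 : AntitoneOn (fun t => u t * Real.exp (-φ t)) (Ico 0 T) := by
    refine antitoneOn_of_hasDerivWithinAt_nonpos (convex_Ico 0 T)
      (f' := fun t => u' t * Real.exp (-φ t) + u t * (Real.exp (-φ t) * -ρ t)) ?_ ?_ ?_
    · exact huc.mul (Real.continuous_exp.comp_continuousOn hφc.neg)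
    · intro t ht
      rw [interior_Ico] at ht
      exact ((hu t ⟨ht.1.le, ht.2⟩).mul (hφ t ht).neg.exp).hasDerivWithinAt
    · intro t ht
      rw [interior_Ico] at ht
      have := (abs_le.mp (hu' t ht)).2
      have e := Real.exp_pos (-φ t)
      nlinarith
  have h2 : MonotoneOn (fun t => u t * Real.exp (φ t)) (Ico 0 T) := by
    refine monotoneOn_of_hasDerivWithinAt_nonneg (convex_Ico 0 T)
      (f' := fun t => u' t * Real.exp (φ t) + u t * (Real.exp (φ t) * ρ t)) ?_ ?_ ?_
    · exact huc.mul (Real.continuous_exp.comp_continuousOn hφc)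
    · intro t ht
      rw [interior_Ico] at ht
      exact ((hu t ⟨ht.1.le, ht.2⟩).mul (hφ t ht).exp).hasDerivWithinAt
    · intro t ht
      rw [interior_Ico] at ht
      have := (abs_le.mp (hu' t ht)).1
      have e := Real.exp_pos (φ t)
      nlinarith
  have h3 := h1 h0 ht ht.1
  have h4 := h2 h0 ht ht.1
  simp only [hφ0, neg_zero, Real.exp_zero, mul_one] at h3 h4
  rw [Real.exp_neg] at h3 ⊢
  have e := Real.exp_pos (φ t)
  constructor
  · rwa [← div_eq_mul_inv, div_le_iff₀ e, mul_comm] at h3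
  · rwa [inv_mul_le_iff₀ e, mul_comm]

theorem integrableOn_uIcc_of_Ioo {X : Type*} [NormedAddCommGroup X] {f : ℝ → X} {a b : ℝ}
    (hab : a ≤ b) (hf : IntegrableOn f (Ioo a b)) : IntegrableOn f (uIcc a b) := by
  rwa [uIcc_of_le hab, integrableOn_Icc_iff_integrableOn_Ioo]

/-- A solution of the linear equation `H' = -R H` with `‖R‖` integrable has an invertible limit. -/
theorem exists_isUnit_limit {V : Type*} [NormedAddCommGroup V] [InnerProductSpace ℝ V]
    [FiniteDimensional ℝ V] {a : EReal} (ha : a < 0) {T : ℝ} (hT : 0 < T) {H R : ℝ → V →L[ℝ] V}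
    (h0 : H 0 = 1) (hH : ∀ t ∈ timeInterval a T, HasDerivAt H (-(R t * H t)) t)
    (hR : ContinuousOn R (timeInterval a T)) (hint : ∫⁻ t in Ioo 0 T, ‖R t‖ₑ < ⊤) :
    ∃ A : V →L[ℝ] V, IsUnit A ∧ Tendsto H (𝓝[<] T) (𝓝 A) := by
  have hsub : Ico 0 T ⊆ timeInterval a T := fun t ht => mem_timeInterval_coe.mpr
    ⟨ha.trans_le (EReal.coe_nonneg.mpr ht.1), ht.2⟩
  have hsub' : Ioo 0 T ⊆ timeInterval a T := Ioo_subset_Ico_self.trans hsub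
  have hRint : IntegrableOn R (Ioo 0 T) :=
    ⟨(hR.mono hsub').aestronglyMeasurable measurableSet_Ioo, hint⟩
  -- The factor `2` comes from differentiating `‖H t v‖ ^ 2`. `R` may be unbounded near `T`, but its
  -- integrability bounds the primitive `φ`.
  let ρ : ℝ → ℝ := fun t => 2 * ‖R t‖
  have hρ : IntegrableOn ρ (uIcc 0 T) := integrableOn_uIcc_of_Ioo hT.le (hRint.norm.const_mul 2)
  let φ : ℝ → ℝ := fun t => ∫ w in (0 : ℝ)..t, ρ w
  have hφc : ContinuousOn φ (uIcc 0 T) := intervalIntegral.continuousOn_primitive_interval hρ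
  have hρc : ContinuousOn ρ (timeInterval a T) := continuousOn_const.mul hR.norm
  have hφ : ∀ t ∈ Ioo 0 T, HasDerivAt φ (ρ t) t := by
    intro t ht
    have hii : IntervalIntegrable ρ volume 0 t :=
      (hρ.mono_set (uIcc_subset_uIcc_left (by rw [uIcc_of_le hT.le]; exact ⟨ht.1.le, ht.2.le⟩))).intervalIntegrable
    refine intervalIntegral.integral_hasDerivAt_right hii ?_ ?_
    · exact hρc.stronglyMeasurableAtFilter (isOpen_timeInterval a T) t (hsub' ht)
    · exact hρc.continuousAt ((isOpen_timeInterval a T).mem_nhds (hsub' ht))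
  have hφT : ∃ Φ, ∀ t ∈ Ico 0 T, φ t ≤ Φ := by
    obtain ⟨Φ, hΦ⟩ := (isCompact_uIcc.image_of_continuousOn hφc).bddAbove
    exact ⟨Φ, fun t ht => hΦ ⟨t, by rw [uIcc_of_le hT.le]; exact ⟨ht.1, ht.2.le⟩, rfl⟩⟩
  obtain ⟨Φ, hΦ⟩ := hφT
  have hbd : ∀ v, ∀ t ∈ Ico 0 T, ‖H t v‖ ^ 2 ≤ Real.exp (φ t) * ‖v‖ ^ 2 ∧
      Real.exp (-φ t) * ‖v‖ ^ 2 ≤ ‖H t v‖ ^ 2 := by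
    intro v t ht
    have hd : ∀ t ∈ Ico 0 T, HasDerivAt (fun t => ‖H t v‖ ^ 2)
        (2 * inner ℝ (H t v) (-(R t (H t v)))) t := by
      intro t ht
      have h1 : HasDerivAt (fun t => H t v) (-(R t (H t v))) t := by
        have := (hH t (hsub ht)).clm_apply (hasDerivAt_const t v)
        simpa using this
      exact h1.norm_sq
    have := growth_bounds (ρ := ρ) (φ := φ) hd
      (hφc.mono (by rw [uIcc_of_le hT.le]; exact Ico_subset_Icc_self)) hφ ?_ (by simp [φ]) ht
    · simpa [h0] using this
    · intro t ht
      rw [abs_mul, abs_two, inner_neg_right, abs_neg]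
      have h1 := abs_real_inner_le_norm (H t v) (R t (H t v))
      have h2 := (R t).le_opNorm (H t v)
      have h3 := norm_nonneg (H t v)
      simp only [ρ]
      nlinarith
  have hHn : ∀ t ∈ Ico 0 T, ‖H t‖ ≤ Real.exp (Φ / 2) := by
    intro t ht
    refine (H t).opNorm_le_bound (Real.exp_pos _).le fun v => ?_
    refine le_of_sq_le_sq ?_ (by positivity)
    rw [mul_pow, ← Real.exp_nat_mul]
    refine (hbd v t ht).1.trans ?_
    gcongr
    have := hΦ t ht
    push_cast
    linarith
  -- With `H` bounded, `H' = D` is integrable up to `T`, so that `H`, being its primitive,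
  -- converges.
  let D : ℝ → V →L[ℝ] V := fun t => -(R t * H t)
  have hHc : ContinuousOn H (timeInterval a T) := fun t ht => (hH t ht).continuousAt.continuousWithinAt
  have hDc : ContinuousOn D (timeInterval a T) := (hR.mul hHc).neg
  have hD : IntegrableOn D (Ioo 0 T) := by
    refine Integrable.mono' (hRint.norm.mul_const (Real.exp (Φ / 2)))
      ((hDc.mono hsub').aestronglyMeasurable measurableSet_Ioo) ?_
    refine (ae_restrict_iff' measurableSet_Ioo).mpr (Eventually.of_forall fun t ht => ?_)
    rw [norm_neg]
    refine (norm_mul_le _ _).trans ?_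
    gcongr
    exact hHn t ⟨ht.1.le, ht.2⟩
  have hDi := integrableOn_uIcc_of_Ioo hT.le hD
  have hprim := intervalIntegral.continuousOn_primitive_interval hDi
  have hHt : ∀ t ∈ Ico 0 T, H t = 1 + ∫ w in (0 : ℝ)..t, D w := by
    intro t ht
    rw [intervalIntegral.integral_eq_sub_of_hasDerivAt (f := H), h0]
    · abel
    · intro w hw
      rw [uIcc_of_le ht.1] at hw
      exact hH w (hsub ⟨hw.1, hw.2.trans_lt ht.2⟩)
    · refine (hDi.mono_set (uIcc_subset_uIcc_left ?_)).intervalIntegrable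
      rw [uIcc_of_le hT.le]; exact ⟨ht.1, ht.2.le⟩
  have hev : ∀ᶠ t in 𝓝[<] T, t ∈ Ico 0 T := by
    filter_upwards [Ioo_mem_nhdsLT hT] with t ht using ⟨ht.1.le, ht.2⟩
  have hlim : Tendsto H (𝓝[<] T) (𝓝 (1 + ∫ w in (0 : ℝ)..T, D w)) := by
    have h1 : Tendsto (fun t => ∫ w in (0 : ℝ)..t, D w) (𝓝[<] T) (𝓝 (∫ w in (0 : ℝ)..T, D w)) := by
      have h2 := hprim T right_mem_uIcc
      refine h2.mono_left (le_inf nhdsWithin_le_nhds ?_)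
      rw [le_principal_iff, uIcc_of_le hT.le]
      filter_upwards [hev] with t ht using ⟨ht.1, ht.2.le⟩
    refine (h1.const_add 1).congr' ?_
    filter_upwards [hev] with t ht using (hHt t ht).symm
  refine ⟨_, ?_, hlim⟩
  set A := 1 + ∫ w in (0 : ℝ)..T, D w
  -- The lower bound `exp(-Φ)‖v‖² ≤ ‖H t v‖²` is uniform in `t` and survives in the limit.
  have hA : Function.Injective A := by
    rw [injective_iff_map_eq_zero]
    intro v hv
    have h1 : Tendsto (fun t => ‖H t v‖ ^ 2) (𝓝[<] T) (𝓝 (‖A v‖ ^ 2)) :=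
      (((ContinuousLinearMap.apply ℝ V v).continuous.tendsto A).comp hlim).norm.pow 2
    have h2 : Real.exp (-Φ) * ‖v‖ ^ 2 ≤ ‖A v‖ ^ 2 := by
      refine ge_of_tendsto h1 ?_
      filter_upwards [hev] with t ht
      refine le_trans ?_ (hbd v t ht).2
      gcongr
      exact hΦ t ht
    rw [hv, norm_zero] at h2
    have := Real.exp_pos (-Φ)
    have h3 : ‖v‖ ^ 2 ≤ 0 := by
      by_contra h
      push Not at h
      have := mul_pos this h
      simp at h2
      linarith
    simpa using h3
  let e := LinearEquiv.ofInjectiveEndo (A : V →ₗ[ℝ] V) hA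
  exact ⟨ContinuousLinearEquiv.toUnit e.toContinuousLinearEquiv, by ext v; rfl⟩

end Analysis

end HomogeneousFlow

end

noncomputable section

namespace HomogeneousFlow

/-! ### Automorphisms as units of the operator algebra. -/

section Operators

variable {V : Type*} [NormedAddCommGroup V] [NormedSpace ℝ V] [FiniteDimensional ℝ V]

/-- A linear automorphism as a unit of the algebra of continuous operators. -/
def unitOfEquiv (f : V ≃ₗ[ℝ] V) : (V →L[ℝ] V)ˣ where
  val := LinearMap.toContinuousLinearMap f.toLinearMap
  inv := LinearMap.toContinuousLinearMap f.symm.toLinearMap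
  val_inv := by ext v; simp
  inv_val := by ext v; simp

@[simp]
theorem unitOfEquiv_apply (f : V ≃ₗ[ℝ] V) (v : V) : (unitOfEquiv f : V →L[ℝ] V) v = f v := rfl

theorem coe_unitOfEquiv (f : V ≃ₗ[ℝ] V) :
    ((unitOfEquiv f : V →L[ℝ] V) : V →ₗ[ℝ] V) = f.toLinearMap := rfl

theorem inverse_unitOfEquiv (f : V ≃ₗ[ℝ] V) :
    Ring.inverse (unitOfEquiv f : V →L[ℝ] V) = (unitOfEquiv f.symm : V →L[ℝ] V) := by
  rw [Ring.inverse_unit]; rfl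

theorem exists_eq_unitOfEquiv {a : V →L[ℝ] V} (ha : IsUnit a) :
    ∃ f : V ≃ₗ[ℝ] V, a = (unitOfEquiv f : V →L[ℝ] V) := by
  obtain ⟨u, rfl⟩ := ha
  exact ⟨(ContinuousLinearEquiv.unitsEquiv ℝ V u).toLinearEquiv, by ext v; rfl⟩

/-- A curve of operators is differentiable if it is so pointwise. -/
theorem hasDerivAt_clm_of_apply {W : Type*} [NormedAddCommGroup W] [NormedSpace ℝ W]
    {H : ℝ → V →L[ℝ] W} {D : V →L[ℝ] W} {t : ℝ}
    (h : ∀ v, HasDerivAt (fun w => H w v) (D v) t) : HasDerivAt H D t := by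
  let b := Module.finBasis ℝ V
  -- An operator is a sum of rank-one operators that depend linearly on its values on a basis.
  have hsum : ∀ A : V →L[ℝ] W,
      A = ∑ i, ContinuousLinearMap.smulRightL ℝ V W (LinearMap.toContinuousLinearMap (b.coord i))
        (A (b i)) := by
    intro A
    ext v
    have h1 : A v = A (∑ i, b.repr v i • b i) := by rw [b.sum_repr]
    rw [h1, map_sum]
    simp [sum_apply]
  rw [funext fun w => hsum (H w), hsum D]
  exact HasDerivAt.fun_sum fun i _ =>
    (ContinuousLinearMap.hasFDerivAt _).comp_hasDerivAt t (h (b i))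

end Operators

/-! ### The equation of the gauge curve and its symmetries. -/

section GaugeCurve

variable {N : ℕ} {r s : Fin N → ℕ} {n : ℕ}
variable {γ₀ : MixedTensor r s (Model n)} {𝔮 : Submodule ℝ (Module.End ℝ (Model n))}

/-- From `(h⁻¹)' = -h⁻¹ h' h⁻¹` with `h' = -hQ`. -/
theorem HasDerivAt.unitOfEquiv_symm {V : Type*} [NormedAddCommGroup V] [NormedSpace ℝ V]
    [FiniteDimensional ℝ V] {h : ℝ → V ≃ₗ[ℝ] V} {Q : V →L[ℝ] V} {t : ℝ}
    (hh : HasDerivAt (fun w => (unitOfEquiv (h w) : V →L[ℝ] V))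
      (-((unitOfEquiv (h t) : V →L[ℝ] V) * Q)) t) :
    HasDerivAt (fun w => (unitOfEquiv (h w).symm : V →L[ℝ] V))
      (Q * (unitOfEquiv (h t).symm : V →L[ℝ] V)) t := by
  have := FiniteDimensional.complete ℝ V
  have h1 := (hasFDerivAt_ringInverse (𝕜 := ℝ) (unitOfEquiv (h t))).comp_hasDerivAt t hh
  have h2 : (Ring.inverse ∘ fun w => (unitOfEquiv (h w) : V →L[ℝ] V))
      = fun w => (unitOfEquiv (h w).symm : V →L[ℝ] V) := by
    funext w
    exact inverse_unitOfEquiv (h w)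
  rw [h2] at h1
  refine h1.congr_deriv ?_
  have h3 : ((unitOfEquiv (h t))⁻¹ : (V →L[ℝ] V)ˣ) = unitOfEquiv (h t).symm := rfl
  have h4 : (unitOfEquiv (h t).symm : V →L[ℝ] V) * (unitOfEquiv (h t) : V →L[ℝ] V) = 1 :=
    (unitOfEquiv (h t)).inv_val
  simp [h3, ← mul_assoc, h4]

theorem eq_of_hasDerivAt_zero {E : Type*} [NormedAddCommGroup E] [NormedSpace ℝ E] {J : Set ℝ}
    (hJ : IsOpen J) (hJ' : Convex ℝ J) {f : ℝ → E} (hf : ∀ t ∈ J, HasDerivAt f 0 t) {t u : ℝ}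
    (ht : t ∈ J) (hu : u ∈ J) : f t = f u :=
  hJ.is_const_of_deriv_eq_zero hJ'.isPreconnected
    (fun t ht => (hf t ht).differentiableAt.differentiableWithinAt)
    (fun t ht => (hf t ht).deriv) ht hu

/-- The gauge curve moves the curve of tensors to its initial value, and it satisfies a linear
equation whose coefficient is determined by the moved velocity. -/
theorem gauge_equation {J : Set ℝ} (hJ : IsOpen J) (hJ' : Convex ℝ J) (h0 : (0 : ℝ) ∈ J)
    {h : ℝ → Model n ≃ₗ[ℝ] Model n} {g p : ℝ → MixedTensor r s (Model n)}
    (hg : ∀ t ∈ J, ∀ k v α, HasDerivAt (fun w => g w k v α) (p t k v α) t)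
    (hh0 : h 0 = LinearEquiv.refl ℝ _)
    (hh : ∀ t ∈ J, ∃ Q ∈ complementAt γ₀ 𝔮 (g t), MixedTensor.theta (g t) Q = p t ∧
      ∀ v, HasDerivAt (fun w => h w v) (-(h t (Q v))) t)
    {L : MixedTensor r s (Model n) →ₗ[ℝ] Module.End ℝ (Model n)}
    (hL : ∀ A ∈ complementAt γ₀ 𝔮 (g 0), L (MixedTensor.theta (g 0) A) = A) :
    ∀ t ∈ J, g t = MixedTensor.pull (h t) (g 0) ∧
      HasDerivAt (fun w => (unitOfEquiv (h w) : Model n →L[ℝ] Model n))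
        (-(LinearMap.toContinuousLinearMap (L (MixedTensor.pull (h t).symm (p t)))
          * (unitOfEquiv (h t) : Model n →L[ℝ] Model n))) t := by
  choose! Q hQ hQp hQh using hh
  have hH : ∀ t ∈ J, HasDerivAt (fun w => (unitOfEquiv (h w) : Model n →L[ℝ] Model n))
      (-((unitOfEquiv (h t) : Model n →L[ℝ] Model n) * LinearMap.toContinuousLinearMap (Q t))) t :=
    fun t ht => hasDerivAt_clm_of_apply fun v => by simpa using hQh t ht v
  -- The terms from differentiating `h⁻¹` and `h` add up to minus the moved tensor `θ(Q)g`, which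
  -- cancels the contribution of `g' = p = θ(Q)g`.
  have hinv : ∀ t ∈ J, MixedTensor.pull (h t).symm (g t) = g 0 := by
    intro t ht
    funext k
    ext v α
    have hc : ∀ t ∈ J, HasDerivAt (fun w => MixedTensor.pull (h w).symm (g w) k v α) 0 t := by
      intro t ht
      have h1 := (hH t ht)
      have h2 := HasDerivAt.unitOfEquiv_symm h1
      have h3 := hasDerivAt_comap (t := t) (A := fun w => (h w).symm.toLinearMap)
        (B := fun w => (h w).toLinearMap) (A' := Q t ∘ₗ (h t).symm.toLinearMap)
        (B' := -((h t).toLinearMap ∘ₗ Q t))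
        (fun v φ => (LinearMap.toContinuousLinearMap φ).hasFDerivAt.comp_hasDerivAt t
          (h2.clm_apply (hasDerivAt_const t v) |>.congr_deriv (by simp)))
        (fun v φ => (LinearMap.toContinuousLinearMap φ).hasFDerivAt.comp_hasDerivAt t
          (h1.clm_apply (hasDerivAt_const t v) |>.congr_deriv (by simp)))
        (hg t ht) k v α
      refine h3.congr_deriv ?_
      rw [← hQp t ht, MixedTensor.comap_apply, MixedTensor.theta_apply]
      simp only [LinearMap.comp_neg, ← LinearMap.comp_assoc, MultilinearMap.map_update_neg,
        Finset.sum_neg_distrib, LinearMap.comp_apply]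
      simp only [LinearEquiv.coe_coe]
      ring
    have := eq_of_hasDerivAt_zero hJ hJ' hc ht h0
    rw [this, hh0]
    rfl
  intro t ht
  have hgt : g t = MixedTensor.pull (h t) (g 0) := by
    rw [← hinv t ht, MixedTensor.pull_pull_symm]
  refine ⟨hgt, (hH t ht).congr_deriv ?_⟩
  -- Moved back by `h`, the velocity is `θ(hQh⁻¹)` at `g 0`, and `L` recovers `hQh⁻¹` since it lies
  -- in the complement there. This turns `-hQ` into `-(hQh⁻¹)h`.
  have h1 : L (MixedTensor.pull (h t).symm (p t)) = (h t).conj (Q t) := by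
    have h2 := hQ t ht
    have h3 := hQp t ht
    rw [hgt] at h2 h3
    rw [← h3, MixedTensor.pull_symm_theta_pull]
    exact hL _ (conj_mem_complementAt (h t) h2)
  rw [h1]
  congr 1
  ext1 v
  simp [LinearEquiv.conj_apply]

/-- The gauge curve commutes with the common symmetries of the tensors and of their velocities. -/
theorem gauge_commute (h𝔮 : IsInvariantComplement γ₀ 𝔮)
    {J : Set ℝ} (hJ : IsOpen J) (hJ' : Convex ℝ J) (h0 : (0 : ℝ) ∈ J)
    {h : ℝ → Model n ≃ₗ[ℝ] Model n} {g p : ℝ → MixedTensor r s (Model n)}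
    (hh0 : h 0 = LinearEquiv.refl ℝ _)
    (hh : ∀ t ∈ J, ∃ Q ∈ complementAt γ₀ 𝔮 (g t), MixedTensor.theta (g t) Q = p t ∧
      ∀ v, HasDerivAt (fun w => h w v) (-(h t (Q v))) t)
    {κ : Model n ≃ₗ[ℝ] Model n} (hκ : ∀ t ∈ J, MixedTensor.pull κ (g t) = g t)
    (hκ' : ∀ t ∈ J, MixedTensor.pull κ (p t) = p t) {t : ℝ} (ht : t ∈ J) (v : Model n) :
    h t (κ v) = κ (h t v) := by
  choose! Q hQ hQp hQh using hh
  -- `κQκ⁻¹` lies in the same complement and generates the same velocity, so it equals `Q`.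
  have hcomm : ∀ t ∈ J, ∀ v, Q t (κ v) = κ (Q t v) := by
    intro t ht v
    have h1 : κ.conj (Q t) ∈ complementAt γ₀ 𝔮 (g t) :=
      conj_mem_complementAt κ (by rw [hκ t ht]; exact hQ t ht)
    have h2 : MixedTensor.theta (g t) (κ.conj (Q t)) = MixedTensor.theta (g t) (Q t) := by
      rw [← MixedTensor.pull_symm_theta_pull, hκ t ht, hQp t ht]
      conv_lhs => rw [← hκ' t ht]
      rw [MixedTensor.pull_symm_pull]
    have h3 := LinearMap.congr_fun (complementAt_injOn h𝔮 h1 (hQ t ht) h2) (κ v)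
    simpa [LinearEquiv.conj_apply] using h3.symm
  have hH : ∀ t ∈ J, HasDerivAt (fun w => (unitOfEquiv (h w) : Model n →L[ℝ] Model n))
      (-((unitOfEquiv (h t) : Model n →L[ℝ] Model n) * LinearMap.toContinuousLinearMap (Q t))) t :=
    fun t ht => hasDerivAt_clm_of_apply fun v => by simpa using hQh t ht v
  -- `hκh⁻¹` has derivative `h(κQ - Qκ)h⁻¹ = 0`, and it equals `κ` at time `0`.
  have hc : ∀ t ∈ J, HasDerivAt (fun w => (unitOfEquiv (h w) : Model n →L[ℝ] Model n)
      * (unitOfEquiv κ : Model n →L[ℝ] Model n)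
      * (unitOfEquiv (h w).symm : Model n →L[ℝ] Model n)) 0 t := by
    intro t ht
    have h1 := ((hH t ht).mul_const (unitOfEquiv κ : Model n →L[ℝ] Model n)).mul
      (HasDerivAt.unitOfEquiv_symm (hH t ht))
    refine h1.congr_deriv ?_
    ext1 v
    simp [hcomm t ht]
  have h1 := congrArg (fun A : Model n →L[ℝ] Model n => A (h t v))
    (eq_of_hasDerivAt_zero hJ hJ' hc ht h0)
  simpa [hh0] using h1

end GaugeCurve

/-! ### Comparison of operator norms with the moving tensor norm. -/

section Norm

variable {N : ℕ} {r s : Fin N → ℕ}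

/-- Existence of an orthonormal frame for an inner product. -/
theorem exists_orthonormal_frame {n : ℕ} {V : Type*} [AddCommGroup V] [Module ℝ V]
    [FiniteDimensional ℝ V] (hn : Module.finrank ℝ V = n) (ip : LinearMap.BilinForm ℝ V)
    (hsymm : ∀ v w, ip v w = ip w v) (hpos : ∀ v, v ≠ 0 → 0 < ip v v) :
    ∃ b : Model n ≃ₗ[ℝ] V, ∀ v w, ip (b v) (b w) = inner ℝ v w := by
  let core : InnerProductSpace.Core ℝ V :=
    { inner := fun v w => ip v w
      conj_inner_symm := fun v w => by simp [hsymm w v]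
      re_inner_nonneg := fun v => by
        by_cases hv : v = 0
        · simp [hv]
        · simpa using (hpos v hv).le
      add_left := fun u v w => by simp
      smul_left := fun u v c => by simp
      definite := fun v hv => by
        by_contra h
        exact (hpos v h).ne' hv }
  let : NormedAddCommGroup V := core.toNormedAddCommGroup
  let : InnerProductSpace ℝ V := InnerProductSpace.ofCore core.toCore
  let b := (stdOrthonormalBasis ℝ V).reindex (finCongr hn)
  exact ⟨b.repr.symm.toLinearEquiv, fun v w => b.repr.symm.inner_map_map v w⟩

/-- An operator depending linearly on the moved tensor is bounded by the norm of the tensor. -/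
theorem exists_tensorNorm_bound {n : ℕ} (ip : LinearMap.BilinForm ℝ (Model n))
    (hsymm : ∀ v w, ip v w = ip w v) (hpos : ∀ v, v ≠ 0 → 0 < ip v v)
    {U : Type*} [NormedAddCommGroup U] [NormedSpace ℝ U] [FiniteDimensional ℝ U]
    (L : MixedTensor r s (Model n) →ₗ[ℝ] U) :
    ∃ C : ℝ, ∀ (f : Model n ≃ₗ[ℝ] Model n) (τ : MixedTensor r s (Model n)),
      ‖L (MixedTensor.pull f.symm τ)‖ₑ ≤ ENNReal.ofReal C * tensorNorm n (pullForm f ip) τ := by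
  obtain ⟨b, hb⟩ := exists_orthonormal_frame (n := n) (by simp) ip hsymm hpos
  obtain ⟨C, hC, hL⟩ := MixedTensor.exists_operator_bound (L ∘ₗ MixedTensor.pullₗ b.symm)
  refine ⟨C, fun f τ => ?_⟩
  have h1 := hL (MixedTensor.pull b (MixedTensor.pull f.symm τ))
  rw [LinearMap.comp_apply, MixedTensor.pullₗ_apply, MixedTensor.pull_symm_pull] at h1
  rw [← ofReal_norm]
  refine (ENNReal.ofReal_le_ofReal h1).trans ?_
  rw [ENNReal.ofReal_mul hC]
  gcongr
  rw [MixedTensor.pull_pull]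
  -- `f⁻¹` carries an `ip`-orthonormal frame to one for `f^*ip`. Only this one frame is needed, as
  -- the norm is used here as an upper bound.
  refine le_iSup₂_of_le (b.trans f.symm) (fun v w => ?_) le_rfl
  simpa [pullForm] using hb v w

end Norm

end HomogeneousFlow

end

noncomputable section

namespace HomogeneousFlow

/-! ### Continuation of curves inside a linear space of operators. -/

section OperatorCurves

open scoped Topology
open Filter Set

/-- A solution of `H' = -R(H) H` in a space of operators, with `‖R(H)‖` integrable, extends. -/
theorem exists_operator_extension {V : Type*} [NormedAddCommGroup V] [InnerProductSpace ℝ V]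
    [FiniteDimensional ℝ V] {E : Submodule ℝ (V →L[ℝ] V)} {R : (V →L[ℝ] V) → V →L[ℝ] V}
    (hRE : ∀ x ∈ E, IsUnit x → R x * x ∈ E)
    (hR : ∀ (k : ℕ) (ι : Model k →L[ℝ] (V →L[ℝ] V)), (∀ u, ι u ∈ E) →
      ContDiffOn ℝ ∞ (fun u => R (ι u)) {u | IsUnit (ι u)})
    {a : EReal} (ha : a < 0) {T : ℝ} (hT : 0 < T) {H : ℝ → V →L[ℝ] V} (h0 : H 0 = 1)
    (hH : ∀ t ∈ timeInterval a T, H t ∈ E ∧ IsUnit (H t) ∧ HasDerivAt H (-(R (H t) * H t)) t)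
    (hint : ∫⁻ t in Ioo 0 T, ‖R (H t)‖ₑ < ⊤) :
    ∃ b : ℝ, T < b ∧ ∃ y : ℝ → V →L[ℝ] V, (∀ t ∈ timeInterval a b,
      y t ∈ E ∧ IsUnit (y t) ∧ HasDerivAt y (-(R (y t) * y t)) t) ∧
      ∀ t ∈ timeInterval a T, y t = H t := by
  have := FiniteDimensional.complete ℝ V
  let ψ : E ≃L[ℝ] Model (Module.finrank ℝ E) := toEuclidean
  let ι : Model (Module.finrank ℝ E) →L[ℝ] (V →L[ℝ] V) :=
    E.subtypeL ∘L (ψ.symm : Model (Module.finrank ℝ E) →L[ℝ] E)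
  have hι : ∀ u, ι u ∈ E := fun u => (ψ.symm u).2
  -- A linear retraction onto `E` extends the coordinates to all operators, so that derivatives
  -- taken in the ambient space can be read in `Model k`.
  obtain ⟨P₀, hP₀⟩ := LinearMap.exists_leftInverse_of_injective E.subtype E.ker_subtype
  let P : (V →L[ℝ] V) →L[ℝ] Model (Module.finrank ℝ E) :=
    (ψ : E →L[ℝ] Model (Module.finrank ℝ E)) ∘L LinearMap.toContinuousLinearMap P₀
  have hιP : ∀ x ∈ E, ι (P x) = x := fun x hx => by
    have h1 : P₀ x = ⟨x, hx⟩ := LinearMap.congr_fun hP₀ ⟨x, hx⟩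
    simp [ι, P, h1]
  let U : Set (Model (Module.finrank ℝ E)) := {u | IsUnit (ι u)}
  have hU : IsOpen U := Units.isOpen.preimage ι.continuous
  have hRι : ContDiffOn ℝ ∞ (fun u => R (ι u)) U := hR _ ι hι
  let F : Model (Module.finrank ℝ E) → Model (Module.finrank ℝ E) :=
    fun u => P (-(R (ι u) * ι u))
  have hF : ContDiffOn ℝ ∞ F U :=
    P.contDiff.comp_contDiffOn ((hRι.mul ι.contDiff.contDiffOn).neg)
  have hmem : ∀ x ∈ E, IsUnit x → -(R x * x) ∈ E := fun x hx hu =>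
    E.neg_mem (hRE x hx hu)
  have hHR : ContinuousOn (fun t => R (H t)) (timeInterval a T) := by
    have h1 : ContinuousOn (fun t => R (ι (P (H t)))) (timeInterval a T) :=
      hRι.continuousOn.comp (f := fun t => P (H t))
        (P.continuous.comp_continuousOn fun t ht => (hH t ht).2.2.continuousAt.continuousWithinAt)
        fun t ht => by
          show IsUnit _
          rw [hιP _ (hH t ht).1]
          exact (hH t ht).2.1
    refine h1.congr fun t ht => ?_
    show R (H t) = R (ι (P (H t)))
    rw [hιP _ (hH t ht).1]
  obtain ⟨A, hA, hlim⟩ := exists_isUnit_limit ha hT h0 (fun t ht => (hH t ht).2.2) hHR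
    hint
  have hAE : A ∈ E := by
    refine E.closed_of_finiteDimensional.mem_of_tendsto hlim ?_
    filter_upwards [Ioo_mem_nhdsLT hT] with t ht
    exact (hH t (mem_timeInterval_coe.mpr ⟨ha.trans (EReal.coe_pos.mpr ht.1), ht.2⟩)).1
  obtain ⟨b, hb, z, hz, hzx⟩ := exists_extension_of_tendsto hU hF (a := a) (T := T)
    (x := fun t => P (H t)) (p := P A) (ha.trans (EReal.coe_pos.mpr hT))
    (fun t ht => by
      obtain ⟨h1, h2, h3⟩ := hH t ht
      refine ⟨by show IsUnit _; rwa [hιP _ h1], ?_⟩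
      have h4 := P.hasFDerivAt.comp_hasDerivAt t h3
      refine h4.congr_deriv ?_
      simp only [F]
      rw [hιP _ h1])
    (by show IsUnit _; rwa [hιP _ hAE]) ((P.continuous.tendsto A).comp hlim)
  refine ⟨b, hb, fun t => ι (z t), fun t ht => ⟨hι _, (hz t ht).1, ?_⟩, fun t ht => ?_⟩
  · refine (ι.hasFDerivAt.comp_hasDerivAt t (hz t ht).2).congr_deriv ?_
    exact hιP _ (hmem _ (hι _) (hz t ht).1)
  · show ι (z t) = H t
    rw [hzx t ht, hιP _ (hH t ht).1]

end OperatorCurves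

/-! ### The flow as an ODE on the commutant of the isotropy representation. -/

section GaugedFields

open scoped Topology
open Filter Set

variable {N : ℕ} {r s : Fin N → ℕ} {m n : ℕ}
  {G : Type*} [TopologicalSpace G] [ChartedSpace (Model m) G] [Group G] [LieGroup (𝓡 m) ∞ G]
  {M : Type*} [TopologicalSpace M] [ChartedSpace (Model n) M] [IsManifold (𝓡 n) ∞ M]
  [MulAction G M] [ContMDiffSMul (𝓡 m) (𝓡 n) ∞ G M]

variable (m n G) in
/-- The operators that commute with the isotropy representation at `o`. -/
def isotropyCommutant (o : M) : Submodule ℝ (Model n →L[ℝ] Model n) where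
  carrier := {a | ∀ g : G, g • o = o → ∀ v, a (actionDeriv m n g o v) = actionDeriv m n g o (a v)}
  add_mem' ha hb g hg v := by simp [ha g hg v, hb g hg v]
  zero_mem' g hg v := by simp
  smul_mem' c a ha g hg v := by simp [ha g hg v]

omit [LieGroup (𝓡 m) ∞ G] [IsManifold (𝓡 n) ∞ M] in
theorem mul_mem_isotropyCommutant {o : M} {a b : Model n →L[ℝ] Model n}
    (ha : a ∈ isotropyCommutant m n G o) (hb : b ∈ isotropyCommutant m n G o) :
    a * b ∈ isotropyCommutant m n G o := fun g hg v => by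
  show a (b _) = actionDeriv m n g o (a (b v))
  rw [hb g hg, ha g hg]

/-- The field that is obtained from the value `a^*σ` at the origin, for an operator `a`. -/
def gaugedField (o : M) (sec : M → G) (σ : MixedTensor r s (Model n))
    (a : Model n →L[ℝ] Model n) : TensorField n r s M :=
  invariantField (m := m) o sec
    (MixedTensor.comap (a : Model n →ₗ[ℝ] Model n) (Ring.inverse a : Model n →L[ℝ] Model n) σ)

/-- The operator which generates the velocity of the flow at `a^*σ`, moved back to `σ`. -/
def gaugeOperator (q : TensorField n r s M → TensorField n r s M) (o : M) (sec : M → G)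
    (σ : MixedTensor r s (Model n)) (L : MixedTensor r s (Model n) →ₗ[ℝ] Module.End ℝ (Model n))
    (a : Model n →L[ℝ] Model n) : Model n →L[ℝ] Model n :=
  LinearMap.toContinuousLinearMap (L (MixedTensor.comap
    (Ring.inverse a : Model n →L[ℝ] Model n) (a : Model n →ₗ[ℝ] Model n)
    (q (gaugedField (m := m) o sec σ a) o : MixedTensor r s (Model n))))

variable (m) in
/-- The data of a geometric flow on a homogeneous space with a reference tensor `e^*γ₀` at the
origin that is fixed by the isotropy group. -/
structure IsGaugeModel (γ₀ : MixedTensor r s (Model n))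
    (𝔮 : Submodule ℝ (Module.End ℝ (Model n)))
    (q : TensorField n r s M → TensorField n r s M) (o : M) (sec : M → G)
    (e : Model n ≃ₗ[ℝ] Model n)
    (L : MixedTensor r s (Model n) →ₗ[ℝ] Module.End ℝ (Model n)) : Prop where
  homogeneous : IsHomogeneousSpace (m := m) (n := n) G o
  sec_smul : ∀ x, sec x • o = x
  complement : IsInvariantComplement γ₀ 𝔮
  velocity : IsVelocity γ₀ q
  diffeo : IsDiffeomorphismInvariant γ₀ q
  smooth : IsSmoothOnInvariant (m := m) G γ₀ q o
  isotropic : ∀ g : G, g • o = o →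
    MixedTensor.pull (actionDeriv m n g o) (MixedTensor.pull e γ₀) = MixedTensor.pull e γ₀
  section_theta : ∀ A ∈ complementAt γ₀ 𝔮 (MixedTensor.pull e γ₀),
    L (MixedTensor.theta (MixedTensor.pull e γ₀) A) = A

namespace IsGaugeModel

variable {γ₀ : MixedTensor r s (Model n)} {𝔮 : Submodule ℝ (Module.End ℝ (Model n))}
  {q : TensorField n r s M → TensorField n r s M} {o : M} {sec : M → G}
  {e : Model n ≃ₗ[ℝ] Model n} {L : MixedTensor r s (Model n) →ₗ[ℝ] Module.End ℝ (Model n)}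

omit [LieGroup (𝓡 m) ∞ G] [IsManifold (𝓡 n) ∞ M] in
theorem gaugedField_unitOfEquiv (f : Model n ≃ₗ[ℝ] Model n) (σ : MixedTensor r s (Model n)) :
    gaugedField (m := m) o sec σ (unitOfEquiv f : Model n →L[ℝ] Model n)
      = invariantField (m := m) o sec (MixedTensor.pull f σ) := by
  rw [gaugedField, inverse_unitOfEquiv]; rfl

omit [LieGroup (𝓡 m) ∞ G] in
theorem isotropic_pull (hS : IsGaugeModel m γ₀ 𝔮 q o sec e L) {f : Model n ≃ₗ[ℝ] Model n}
    (hf : (unitOfEquiv f : Model n →L[ℝ] Model n) ∈ isotropyCommutant m n G o) (g : G)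
    (hg : g • o = o) :
    MixedTensor.pull (actionDeriv m n g o) (MixedTensor.pull f (MixedTensor.pull e γ₀))
      = MixedTensor.pull f (MixedTensor.pull e γ₀) := by
  have h1 : (actionDeriv m n g o).trans f = f.trans (actionDeriv m n g o) := by
    ext1 v
    exact hf g hg v
  rw [MixedTensor.pull_pull, h1, ← MixedTensor.pull_pull, hS.isotropic g hg]

omit [LieGroup (𝓡 m) ∞ G] in
theorem gaugedField_apply_self (hS : IsGaugeModel m γ₀ 𝔮 q o sec e L)
    {a : Model n →L[ℝ] Model n} (ha : IsUnit a) (haE : a ∈ isotropyCommutant m n G o) :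
    gaugedField (m := m) o sec (MixedTensor.pull e γ₀) a o = MixedTensor.comap
      (a : Model n →ₗ[ℝ] Model n) (Ring.inverse a : Model n →L[ℝ] Model n)
      (MixedTensor.pull e γ₀) := by
  obtain ⟨f, rfl⟩ := exists_eq_unitOfEquiv ha
  rw [gaugedField_unitOfEquiv, invariantField_apply_self hS.sec_smul (hS.isotropic_pull haE),
    inverse_unitOfEquiv]
  rfl

omit [LieGroup (𝓡 m) ∞ G] in
theorem isInvariant_gaugedField (hS : IsGaugeModel m γ₀ 𝔮 q o sec e L)
    {a : Model n →L[ℝ] Model n} (ha : IsUnit a) (haE : a ∈ isotropyCommutant m n G o) :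
    IsInvariant (m := m) G (gaugedField (m := m) o sec (MixedTensor.pull e γ₀) a) := by
  obtain ⟨f, rfl⟩ := exists_eq_unitOfEquiv ha
  rw [gaugedField_unitOfEquiv]
  exact isInvariant_invariantField hS.sec_smul (hS.isotropic_pull haE)

theorem isGeometricStructure_gaugedField (hS : IsGaugeModel m γ₀ 𝔮 q o sec e L)
    {a : Model n →L[ℝ] Model n} (ha : IsUnit a) (haE : a ∈ isotropyCommutant m n G o) :
    IsGeometricStructure γ₀ (gaugedField (m := m) o sec (MixedTensor.pull e γ₀) a) := by
  obtain ⟨f, rfl⟩ := exists_eq_unitOfEquiv ha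
  rw [gaugedField_unitOfEquiv]
  exact ⟨isSmoothField_invariantField hS.homogeneous hS.sec_smul (hS.isotropic_pull haE),
    fun x => ⟨((actionDeriv m n (sec x) o).symm.trans f).trans e, rfl⟩⟩

omit [LieGroup (𝓡 m) ∞ G] in
-- This is where diffeomorphism invariance enters, applied to the diffeomorphisms of the action.
theorem isInvariant_velocity (hS : IsGaugeModel m γ₀ 𝔮 q o sec e L) {δ : TensorField n r s M}
    (hδ : IsGeometricStructure γ₀ δ) (hδ' : IsInvariant (m := m) G δ) :
    IsInvariant (m := m) G (q δ) := fun g => by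
  rw [← hS.diffeo _ δ hδ, hδ' g]

/-- The velocity at `f^*σ` is tangent to the orbit of that tensor; moved back by `f` it becomes
`θ(A)σ` with `A` in the complement, and `L` returns this `A`. -/
theorem theta_gaugeOperator (hS : IsGaugeModel m γ₀ 𝔮 q o sec e L) {f : Model n ≃ₗ[ℝ] Model n}
    (hf : (unitOfEquiv f : Model n →L[ℝ] Model n) ∈ isotropyCommutant m n G o) :
    (gaugeOperator (m := m) q o sec (MixedTensor.pull e γ₀) L (unitOfEquiv f : Model n →L[ℝ] Model n)
      : Model n →ₗ[ℝ] Model n) ∈ complementAt γ₀ 𝔮 (MixedTensor.pull e γ₀) ∧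
    MixedTensor.theta (MixedTensor.pull e γ₀)
      (gaugeOperator (m := m) q o sec (MixedTensor.pull e γ₀) L
        (unitOfEquiv f : Model n →L[ℝ] Model n) : Model n →ₗ[ℝ] Model n) =
      MixedTensor.pull f.symm (q (gaugedField (m := m) o sec (MixedTensor.pull e γ₀)
        (unitOfEquiv f : Model n →L[ℝ] Model n)) o : MixedTensor r s (Model n)) := by
  have hu := (unitOfEquiv f).isUnit
  have h1 := hS.velocity.sameType _ (hS.isGeometricStructure_gaugedField hu hf) o
  set p : MixedTensor r s (Model n) := q (gaugedField (m := m) o sec (MixedTensor.pull e γ₀)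
        (unitOfEquiv f : Model n →L[ℝ] Model n)) o with hp
  have h2 : gaugedField (m := m) o sec (MixedTensor.pull e γ₀)
      (unitOfEquiv f : Model n →L[ℝ] Model n) o = MixedTensor.pull f (MixedTensor.pull e γ₀) := by
    rw [hS.gaugedField_apply_self hu hf, inverse_unitOfEquiv]; rfl
  rw [h2] at h1
  obtain ⟨B, hB⟩ : ∃ B : Module.End ℝ (Model n),
    MixedTensor.theta (MixedTensor.pull f (MixedTensor.pull e γ₀)) B = p := h1
  have h3 : MixedTensor.pull f.symm p ∈ LinearMap.range
      (MixedTensor.theta (MixedTensor.pull e γ₀)) := by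
    refine ⟨f.conj B, ?_⟩
    rw [← MixedTensor.pull_symm_theta_pull]
    exact congrArg (MixedTensor.pull f.symm) hB
  obtain ⟨A, hA, hAp⟩ := exists_mem_complementAt hS.complement e h3
  have h4 : (gaugeOperator (m := m) q o sec (MixedTensor.pull e γ₀) L
      (unitOfEquiv f : Model n →L[ℝ] Model n) : Model n →ₗ[ℝ] Model n) = A := by
    rw [← hS.section_theta A hA, hAp, gaugeOperator, inverse_unitOfEquiv]
    rfl
  rw [h4]
  exact ⟨hA, hAp⟩

/-- Both `f` and the velocity are compatible with the isotropy group, so conjugation by its elements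
changes neither the infinitesimal action of the operator nor its membership in the complement;
uniqueness applies. This makes the equation tangent to the commutant. -/
theorem gaugeOperator_mem (hS : IsGaugeModel m γ₀ 𝔮 q o sec e L)
    {a : Model n →L[ℝ] Model n} (ha : IsUnit a) (haE : a ∈ isotropyCommutant m n G o) :
    gaugeOperator (m := m) q o sec (MixedTensor.pull e γ₀) L a ∈ isotropyCommutant m n G o := by
  have hinv := hS.isInvariant_velocity (hS.isGeometricStructure_gaugedField ha haE)
    (hS.isInvariant_gaugedField ha haE)
  obtain ⟨f, rfl⟩ := exists_eq_unitOfEquiv ha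
  obtain ⟨h1, h2⟩ := hS.theta_gaugeOperator haE
  set A := gaugeOperator (m := m) q o sec (MixedTensor.pull e γ₀) L
    (unitOfEquiv f : Model n →L[ℝ] Model n)
  obtain ⟨p, hp⟩ : ∃ p : MixedTensor r s (Model n), p = q (gaugedField (m := m) o sec
    (MixedTensor.pull e γ₀) (unitOfEquiv f : Model n →L[ℝ] Model n)) o := ⟨_, rfl⟩
  have h2 : MixedTensor.theta (MixedTensor.pull e γ₀) (A : Model n →ₗ[ℝ] Model n)
      = MixedTensor.pull f.symm p := by rw [hp]; exact h2
  intro g hg v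
  set κ := actionDeriv m n g o
  have hκ : MixedTensor.pull κ (MixedTensor.pull e γ₀) = MixedTensor.pull e γ₀ := hS.isotropic g hg
  have h3 : κ.conj (A : Model n →ₗ[ℝ] Model n) ∈ complementAt γ₀ 𝔮 (MixedTensor.pull e γ₀) :=
    conj_mem_complementAt κ (by rw [hκ]; exact h1)
  have h4 : κ.trans f.symm = f.symm.trans κ := by
    ext1 w
    apply f.injective
    have := haE g hg (f.symm w)
    simp only [unitOfEquiv_apply] at this
    simp [κ, this]
  have h5 : MixedTensor.theta (MixedTensor.pull e γ₀) (κ.conj (A : Model n →ₗ[ℝ] Model n))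
      = MixedTensor.theta (MixedTensor.pull e γ₀) (A : Model n →ₗ[ℝ] Model n) := by
    rw [← MixedTensor.pull_symm_theta_pull, hκ, h2]
    have h6 := hinv.pull_actionDeriv g o
    rw [hg] at h6
    have h6 : MixedTensor.pull κ p = p := by rw [hp]; exact h6
    conv_lhs => rw [← h6]
    rw [MixedTensor.pull_pull, MixedTensor.pull_pull]
    congr 1
    ext1 w
    have := LinearEquiv.congr_fun h4 (κ.symm w)
    simpa [κ] using this.symm
  have h6 := LinearMap.congr_fun (complementAt_injOn hS.complement h3 h1 h5) (κ v)
  simpa [LinearEquiv.conj_apply] using h6.symm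

/-- Smoothness of `q` is assumed only along finite-dimensional families of invariant structures,
hence the linear parametrization `ι` with values in the commutant. -/
theorem contDiffOn_gaugeOperator (hS : IsGaugeModel m γ₀ 𝔮 q o sec e L) {k : ℕ}
    (ι : Model k →L[ℝ] (Model n →L[ℝ] Model n)) (hι : ∀ u, ι u ∈ isotropyCommutant m n G o) :
    ContDiffOn ℝ ∞ (fun u => gaugeOperator (m := m) q o sec (MixedTensor.pull e γ₀) L (ι u))
      {u | IsUnit (ι u)} := by
  have hU : IsOpen {u | IsUnit (ι u)} := Units.isOpen.preimage ι.continuous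
  have hs1 : ∀ v (φ : Module.Dual ℝ (Model n)), ∀ u, ContMDiffAt 𝓘(ℝ, Model k) 𝓘(ℝ, ℝ) ∞
      (fun u => φ (ι u v)) u := fun v φ u => by
    rw [contMDiffAt_iff_contDiffAt]
    exact (LinearMap.toContinuousLinearMap φ).contDiff.contDiffAt.comp u
      (ι.contDiff.contDiffAt.clm_apply contDiffAt_const)
  have hs2 : ∀ v (φ : Module.Dual ℝ (Model n)), ∀ u, IsUnit (ι u) →
      ContMDiffAt 𝓘(ℝ, Model k) 𝓘(ℝ, ℝ) ∞ (fun u => φ (Ring.inverse (ι u) v)) u :=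
    fun v φ u hu => by
      rw [contMDiffAt_iff_contDiffAt]
      obtain ⟨w, hw⟩ := hu
      have h1 : ContDiffAt ℝ ∞ Ring.inverse (ι u) := by
        rw [← hw]; exact contDiffAt_ringInverse ℝ w
      exact (LinearMap.toContinuousLinearMap φ).contDiff.contDiffAt.comp u
        ((h1.comp u ι.contDiff.contDiffAt).clm_apply contDiffAt_const)
  have hδ := hS.smooth k {u | IsUnit (ι u)}
    (fun u => gaugedField (m := m) o sec (MixedTensor.pull e γ₀) (ι u)) hU
    (fun u hu => ⟨hS.isGeometricStructure_gaugedField hu (hι u),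
      hS.isInvariant_gaugedField hu (hι u)⟩) ?_
  · intro u hu
    refine ContDiffAt.contDiffWithinAt ?_
    have h1 : ∀ i v α, ContDiffAt ℝ ∞ (fun u => MixedTensor.comap
        (Ring.inverse (ι u) : Model n →L[ℝ] Model n) (ι u : Model n →ₗ[ℝ] Model n)
        (q (gaugedField (m := m) o sec (MixedTensor.pull e γ₀) (ι u)) o
          : MixedTensor r s (Model n)) i v α) u := by
      intro i v α
      rw [← contMDiffAt_iff_contDiffAt]
      refine contMDiffAt_comap (fun v φ => hs2 v φ u hu) (fun v φ => hs1 v φ u) ?_ i v α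
      intro i v α
      rw [contMDiffAt_iff_contDiffAt]
      exact (hδ i v α).contDiffAt (hU.mem_nhds hu)
    have h2 : ∀ φ : Module.Dual ℝ (MixedTensor r s (Model n)), ContDiffAt ℝ ∞ (fun u => φ
        (MixedTensor.comap (Ring.inverse (ι u) : Model n →L[ℝ] Model n)
          (ι u : Model n →ₗ[ℝ] Model n)
          (q (gaugedField (m := m) o sec (MixedTensor.pull e γ₀) (ι u)) o
          : MixedTensor r s (Model n)))) u :=
      MixedTensor.dual_induction_eval h1 contDiffAt_const (fun _ _ h h' => h.add h')
        fun c _ h => contDiffAt_const.mul h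
    let Λ : MixedTensor r s (Model n) →ₗ[ℝ] (Model n →L[ℝ] Model n) :=
      LinearMap.toContinuousLinearMap.toLinearMap ∘ₗ L
    let b := Module.finBasis ℝ (Model n →L[ℝ] Model n)
    have h3 : (fun u => gaugeOperator (m := m) q o sec (MixedTensor.pull e γ₀) L (ι u))
        = fun u => ∑ i, (b.coord i ∘ₗ Λ)
        (MixedTensor.comap (Ring.inverse (ι u) : Model n →L[ℝ] Model n)
          (ι u : Model n →ₗ[ℝ] Model n)
          (q (gaugedField (m := m) o sec (MixedTensor.pull e γ₀) (ι u)) o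
          : MixedTensor r s (Model n))) • b i := by
      funext u
      exact (b.sum_repr _).symm
    rw [h3]
    exact ContDiffAt.sum fun i _ => (h2 _).smul contDiffAt_const
  · intro i v α u hu
    refine ContDiffAt.contDiffWithinAt ?_
    have h1 := contMDiffAt_comap (τ := fun _ : Model k => MixedTensor.pull e γ₀)
      (fun v φ => hs1 v φ u) (fun v φ => hs2 v φ u hu)
      (fun _ _ _ => contMDiffAt_const) i v α
    rw [contMDiffAt_iff_contDiffAt] at h1
    refine h1.congr_of_eventuallyEq ?_
    filter_upwards [hU.mem_nhds hu] with u' hu'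
    exact congrArg (fun τ : MixedTensor r s (Model n) => τ i v α)
      (hS.gaugedField_apply_self hu' (hι u'))

/-- Integral curves of the gauge equation yield solutions of the flow. -/
theorem isInvariantSolution_gaugedField (hS : IsGaugeModel m γ₀ 𝔮 q o sec e L) {a b : EReal}
    {y : ℝ → Model n →L[ℝ] Model n}
    (hy : ∀ t ∈ timeInterval a b, y t ∈ isotropyCommutant m n G o ∧ IsUnit (y t) ∧ HasDerivAt y
      (-(gaugeOperator (m := m) q o sec (MixedTensor.pull e γ₀) L (y t) * y t)) t) :
    IsInvariantSolution (m := m) G γ₀ q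
      (fun t => gaugedField (m := m) o sec (MixedTensor.pull e γ₀) (y t)) a b := by
  have hgeo := fun t ht => hS.isGeometricStructure_gaugedField (hy t ht).2.1 (hy t ht).1
  have hinv := fun t ht => hS.isInvariant_gaugedField (hy t ht).2.1 (hy t ht).1
  have hev : ∀ t ∈ timeInterval a b, ∀ᶠ w in 𝓝 t, w ∈ timeInterval a b := fun t ht =>
    (isOpen_timeInterval a b).mem_nhds ht
  -- The flow equation is verified at `o`; by invariance of the fields and of their velocities,
  -- evaluation at `x` is evaluation at `o` on arguments independent of time.
  have horigin : ∀ t ∈ timeInterval a b, ∀ k (v : Fin (r k) → Model n)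
      (α : Fin (s k) → Module.Dual ℝ (Model n)),
      HasDerivAt (fun w => gaugedField (m := m) o sec (MixedTensor.pull e γ₀) (y w) o k v α)
        (q (gaugedField (m := m) o sec (MixedTensor.pull e γ₀) (y t)) o k v α) t := by
    intro t ht k v α
    obtain ⟨hE, hu, hd⟩ := hy t ht
    obtain ⟨f, hf⟩ := exists_eq_unitOfEquiv hu
    have hθ := (hS.theta_gaugeOperator (hf ▸ hE)).2
    rw [← hf] at hθ
    set A := gaugeOperator (m := m) q o sec (MixedTensor.pull e γ₀) L (y t)
    have hd' : HasDerivAt (fun w => Ring.inverse (y w))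
        ((unitOfEquiv f.symm : Model n →L[ℝ] Model n) * A) t := by
      have h1 : HasFDerivAt Ring.inverse _ (y t) :=
        hf ▸ hasFDerivAt_ringInverse (𝕜 := ℝ) (unitOfEquiv f)
      refine (h1.comp_hasDerivAt t hd).congr_deriv ?_
      rw [hf]
      have h3 : ((unitOfEquiv f)⁻¹ : (Model n →L[ℝ] Model n)ˣ) = unitOfEquiv f.symm := rfl
      ext1 v
      simp [h3]
    have h1 := hasDerivAt_comap (t := t) (A := fun w => (y w : Model n →ₗ[ℝ] Model n))
      (B := fun w => ((Ring.inverse (y w) : Model n →L[ℝ] Model n) : Model n →ₗ[ℝ] Model n))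
      (A' := -((A : Model n →ₗ[ℝ] Model n) ∘ₗ f.toLinearMap))
      (B' := f.symm.toLinearMap ∘ₗ (A : Model n →ₗ[ℝ] Model n))
      (τ := fun _ => MixedTensor.pull e γ₀) (τ' := 0)
      (fun v φ => (LinearMap.toContinuousLinearMap φ).hasFDerivAt.comp_hasDerivAt t
        (hd.clm_apply (hasDerivAt_const t v) |>.congr_deriv (by simp [hf])))
      (fun v φ => (LinearMap.toContinuousLinearMap φ).hasFDerivAt.comp_hasDerivAt t
        (hd'.clm_apply (hasDerivAt_const t v) |>.congr_deriv (by simp)))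
      (fun k v α => hasDerivAt_const t _) k v α
    refine (h1.congr_of_eventuallyEq ?_).congr_deriv ?_
    · filter_upwards [hev t ht] with w hw
      exact congrArg (fun τ : MixedTensor r s (Model n) => τ k v α)
        (hS.gaugedField_apply_self (hy w hw).2.1 (hy w hw).1)
    · obtain ⟨p, hp⟩ : ∃ p : MixedTensor r s (Model n),
        p = q (gaugedField (m := m) o sec (MixedTensor.pull e γ₀) (y t)) o := ⟨_, rfl⟩
      have h2 : MixedTensor.pull f (MixedTensor.theta (MixedTensor.pull e γ₀)
          (A : Model n →ₗ[ℝ] Model n)) = p := by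
        rw [← MixedTensor.pull_pull_symm f p, hp]
        exact congrArg (MixedTensor.pull f) hθ
      replace h2 := congrArg (fun τ : MixedTensor r s (Model n) => τ k v α) (h2.trans hp)
      refine Eq.trans ?_ h2
      rw [MixedTensor.pull_apply, MixedTensor.theta_apply, hf, inverse_unitOfEquiv]
      simp only [MixedTensor.comap_apply, coe_unitOfEquiv, LinearMap.neg_apply,
        MultilinearMap.map_update_neg, LinearMap.comp_apply, LinearEquiv.coe_coe, ← LinearMap.comp_assoc]
      have h0 : (0 : MixedTensor r s (Model n)) k (fun i => f (v i))
        (fun j => α j ∘ₗ f.symm.toLinearMap) = 0 := rfl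
      rw [h0]
      simp only [neg_apply, Finset.sum_neg_distrib]
      ring
  refine ⟨hgeo, hinv, fun t ht x k v α => ?_⟩
  have hx : (sec x)⁻¹ • x = o := by rw [inv_smul_eq_iff, hS.sec_smul]
  have h1 : ∀ τ : TensorField n r s M, IsInvariant (m := m) G τ → τ x k v α
      = τ o k (fun i => actionDeriv m n (sec x)⁻¹ x (v i))
        (fun j => α j ∘ₗ (actionDeriv m n (sec x)⁻¹ x).symm.toLinearMap) := by
    intro τ hτ
    have h2 := hτ.pull_actionDeriv (sec x)⁻¹ x
    rw [hx] at h2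
    exact (congrArg (fun τ : MixedTensor r s (Model n) => τ k v α) h2).symm
  rw [h1 _ (hS.isInvariant_velocity (hgeo t ht) (hinv t ht))]
  refine (horigin t ht k _ _).congr_of_eventuallyEq ?_
  filter_upwards [hev t ht] with w hw using h1 _ (hinv w hw)

/-- An integral curve of the gauge equation with integrable coefficient extends. -/
theorem exists_extension (hS : IsGaugeModel m γ₀ 𝔮 q o sec e L) {c : ℝ} (hc : |c| = 1)
    {a : EReal} (ha : a < 0) {T : ℝ} (hT : 0 < T) {H : ℝ → Model n →L[ℝ] Model n} (h0 : H 0 = 1)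
    (hH : ∀ t ∈ timeInterval a T, H t ∈ isotropyCommutant m n G o ∧ IsUnit (H t) ∧ HasDerivAt H
      (-(c • gaugeOperator (m := m) q o sec (MixedTensor.pull e γ₀) L (H t) * H t)) t)
    (hint : ∫⁻ t in Ioo 0 T,
      ‖gaugeOperator (m := m) q o sec (MixedTensor.pull e γ₀) L (H t)‖ₑ < ⊤) :
    ∃ b : ℝ, T < b ∧ ∃ y : ℝ → Model n →L[ℝ] Model n, (∀ t ∈ timeInterval a b,
      y t ∈ isotropyCommutant m n G o ∧ IsUnit (y t) ∧ HasDerivAt y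
      (-(c • gaugeOperator (m := m) q o sec (MixedTensor.pull e γ₀) L (y t) * y t)) t) ∧
      ∀ t ∈ timeInterval a T, y t = H t := by
  have h1 := exists_operator_extension (E := isotropyCommutant m n G o)
    (R := fun x => c • gaugeOperator (m := m) q o sec (MixedTensor.pull e γ₀) L x)
    (fun x hx hu => mul_mem_isotropyCommutant
      (Submodule.smul_mem _ c (hS.gaugeOperator_mem hu hx)) hx)
    (fun k ι hι => (hS.contDiffOn_gaugeOperator ι hι).const_smul c) ha hT h0 hH
  refine h1 ?_
  have hcR : ∀ x : Model n →L[ℝ] Model n, ‖c • x‖ₑ = ‖x‖ₑ := fun x => by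
    rw [enorm_smul, Real.enorm_eq_ofReal_abs, hc, ENNReal.ofReal_one, one_mul]
  simp_rw [hcR]
  exact hint

end IsGaugeModel

end GaugedFields

end HomogeneousFlow

end

noncomputable section

namespace HomogeneousFlow

/-! ### From an integrable moving norm to an extension of the solution. -/

section Main

open scoped Topology
open Filter Set

variable {N : ℕ} {r s : Fin N → ℕ} {m n : ℕ}
  {G : Type*} [TopologicalSpace G] [ChartedSpace (Model m) G] [Group G] [LieGroup (𝓡 m) ∞ G]
  {M : Type*} [TopologicalSpace M] [ChartedSpace (Model n) M] [IsManifold (𝓡 n) ∞ M]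
  [MulAction G M] [ContMDiffSMul (𝓡 m) (𝓡 n) ∞ G M]

theorem neg_mem_timeInterval {a b : EReal} {t : ℝ} :
    -t ∈ timeInterval a b ↔ t ∈ timeInterval (-b) (-a) := by
  simp only [timeInterval, mem_ofPred_eq, EReal.coe_neg]
  rw [EReal.lt_neg_comm, EReal.neg_lt_comm, and_comm]

omit [LieGroup (𝓡 m) ∞ G] in
/-- The gauge curve of a solution is an integral curve of the gauge equation of a model whose
coefficient is bounded by the moving norm of the velocity. -/
theorem IsInvariantSolution.exists_gaugeModel {o : M}
    (hM : IsHomogeneousSpace (m := m) (n := n) G o)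
    {γ₀ : MixedTensor r s (Model n)} {𝔮 : Submodule ℝ (Module.End ℝ (Model n))}
    (h𝔮 : IsInvariantComplement γ₀ 𝔮) {q : TensorField n r s M → TensorField n r s M}
    (hq : IsVelocity γ₀ q) (hdiff : IsDiffeomorphismInvariant γ₀ q)
    (hsmooth : IsSmoothOnInvariant (m := m) G γ₀ q o)
    {γ : ℝ → TensorField n r s M} {a b : EReal} (ha : a < 0) (hb : 0 < b)
    (hγ : IsInvariantSolution (m := m) G γ₀ q γ a b)
    {ip : LinearMap.BilinForm ℝ (Model n)} (hip_symm : ∀ v w, ip v w = ip w v)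
    (hip_pos : ∀ v, v ≠ 0 → 0 < ip v v) {h : ℝ → Model n ≃ₗ[ℝ] Model n}
    (hh : IsGaugeCurve γ₀ 𝔮 q γ a b o h) :
    ∃ (sec : M → G) (e : Model n ≃ₗ[ℝ] Model n)
      (L : MixedTensor r s (Model n) →ₗ[ℝ] Module.End ℝ (Model n)) (C : ℝ),
      IsGaugeModel m γ₀ 𝔮 q o sec e L ∧ ∀ t ∈ timeInterval a b,
        gaugedField (m := m) o sec (MixedTensor.pull e γ₀)
          (unitOfEquiv (h t) : Model n →L[ℝ] Model n) = γ t ∧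
        (unitOfEquiv (h t) : Model n →L[ℝ] Model n) ∈ isotropyCommutant m n G o ∧
        HasDerivAt (fun w => (unitOfEquiv (h w) : Model n →L[ℝ] Model n))
          (-(gaugeOperator (m := m) q o sec (MixedTensor.pull e γ₀) L
            (unitOfEquiv (h t) : Model n →L[ℝ] Model n) *
            (unitOfEquiv (h t) : Model n →L[ℝ] Model n))) t ∧
        ‖gaugeOperator (m := m) q o sec (MixedTensor.pull e γ₀) L
            (unitOfEquiv (h t) : Model n →L[ℝ] Model n)‖ₑ ≤
          ENNReal.ofReal C * tensorNorm n (pullForm (h t) ip)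
            (q (γ t) o : MixedTensor r s (Model n)) := by
  have := hM.transitive
  choose sec hsec using fun x => MulAction.exists_smul_eq G o x
  have h0 : (0 : ℝ) ∈ timeInterval a b := ⟨ha, hb⟩
  obtain ⟨e, he⟩ : ∃ e : Model n ≃ₗ[ℝ] Model n, γ 0 o = MixedTensor.pull e γ₀ :=
    (hγ.geometric 0 h0).nondegenerate o
  obtain ⟨L, hL⟩ := exists_section_theta h𝔮 e
  let g : ℝ → MixedTensor r s (Model n) := fun t => γ t o
  let p : ℝ → MixedTensor r s (Model n) := fun t => q (γ t) o
  have hg0 : g 0 = MixedTensor.pull e γ₀ := he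
  have hgκ : ∀ κ : G, κ • o = o → ∀ t ∈ timeInterval a b,
      MixedTensor.pull (actionDeriv m n κ o) (g t) = g t := by
    intro κ hκ t ht
    have h1 := (hγ.invariant t ht).pull_actionDeriv κ o
    rw [hκ] at h1
    exact h1
  have hS : IsGaugeModel m γ₀ 𝔮 q o sec e L :=
    ⟨hM, hsec, h𝔮, hq, hdiff, hsmooth, fun κ hκ => by rw [← hg0]; exact hgκ κ hκ 0 h0, hL⟩
  have hpκ : ∀ κ : G, κ • o = o → ∀ t ∈ timeInterval a b,
      MixedTensor.pull (actionDeriv m n κ o) (p t) = p t := by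
    intro κ hκ t ht
    have h1 := (hS.isInvariant_velocity (hγ.geometric t ht)
      (hγ.invariant t ht)).pull_actionDeriv κ o
    rw [hκ] at h1
    exact h1
  have hhg : ∀ t ∈ timeInterval a b, ∃ Q ∈ complementAt γ₀ 𝔮 (g t), MixedTensor.theta (g t) Q = p t ∧
      ∀ v, HasDerivAt (fun w => h w v) (-(h t (Q v))) t := hh.2
  have hgauge := gauge_equation (g := g) (p := p) (isOpen_timeInterval a b) (convex_timeInterval a b) h0
    (fun t ht k v α => hγ.hasDerivAt t ht o k v α) hh.1 hhg (L := L) (by rw [hg0]; exact hL)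
  obtain ⟨C, hC⟩ := exists_tensorNorm_bound ip hip_symm hip_pos
    (LinearMap.toContinuousLinearMap.toLinearMap ∘ₗ L)
  refine ⟨sec, e, L, C, hS, fun t ht => ?_⟩
  have hE : (unitOfEquiv (h t) : Model n →L[ℝ] Model n) ∈ isotropyCommutant m n G o :=
    fun κ hκ v => gauge_commute h𝔮 (isOpen_timeInterval a b) (convex_timeInterval a b) h0 hh.1
      hhg (hgκ κ hκ) (hpκ κ hκ) ht v
  have hfield : gaugedField (m := m) o sec (MixedTensor.pull e γ₀)
      -- Both fields are invariant, so comparing them at `o` suffices.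
      (unitOfEquiv (h t) : Model n →L[ℝ] Model n) = γ t := by
    refine IsInvariant.eq_of_apply_eq hsec
      (hS.isInvariant_gaugedField (unitOfEquiv (h t)).isUnit hE) (hγ.invariant t ht) ?_
    rw [hS.gaugedField_apply_self (unitOfEquiv (h t)).isUnit hE, inverse_unitOfEquiv]
    have h1 := (hgauge t ht).1
    rw [hg0] at h1
    exact h1.symm
  have hR : gaugeOperator (m := m) q o sec (MixedTensor.pull e γ₀) L
      (unitOfEquiv (h t) : Model n →L[ℝ] Model n)
      = LinearMap.toContinuousLinearMap (L (MixedTensor.pull (h t).symm (p t))) := by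
    rw [gaugeOperator, hfield, inverse_unitOfEquiv]; rfl
  refine ⟨hfield, hE, ?_, ?_⟩
  · rw [hR]; exact (hgauge t ht).2
  · rw [hR]; exact hC (h t) (p t)

/-- The moving norm of the velocity is not integrable up to a finite-time singularity. -/
theorem IsInvariantSolution.lintegral_tensorNorm_eq_top {o : M}
    (hM : IsHomogeneousSpace (m := m) (n := n) G o)
    {γ₀ : MixedTensor r s (Model n)} {𝔮 : Submodule ℝ (Module.End ℝ (Model n))}
    (h𝔮 : IsInvariantComplement γ₀ 𝔮) {q : TensorField n r s M → TensorField n r s M}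
    (hq : IsVelocity γ₀ q) (hdiff : IsDiffeomorphismInvariant γ₀ q)
    (hsmooth : IsSmoothOnInvariant (m := m) G γ₀ q o)
    {γ : ℝ → TensorField n r s M} {Tminus Tplus : EReal} (hminus : Tminus < 0) (hplus : 0 < Tplus)
    (hγ : IsInvariantSolution (m := m) G γ₀ q γ Tminus Tplus)
    {ip : LinearMap.BilinForm ℝ (Model n)} (hip_symm : ∀ v w, ip v w = ip w v)
    (hip_pos : ∀ v, v ≠ 0 → 0 < ip v v) {h : ℝ → Model n ≃ₗ[ℝ] Model n}
    (hh : IsGaugeCurve γ₀ 𝔮 q γ Tminus Tplus o h) :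
    (HasForwardSingularity (m := m) G γ₀ q γ Tminus Tplus → ∫⁻ t in timeInterval 0 Tplus,
      tensorNorm n (pullForm (h t) ip) (q (γ t) o : MixedTensor r s (Model n)) = ⊤) ∧
    (HasBackwardSingularity (m := m) G γ₀ q γ Tminus Tplus → ∫⁻ t in timeInterval Tminus 0,
      tensorNorm n (pullForm (h t) ip) (q (γ t) o : MixedTensor r s (Model n)) = ⊤) := by
  obtain ⟨sec, e, L, C, hS, hH⟩ := hγ.exists_gaugeModel hM h𝔮 hq hdiff hsmooth hminus hplus
    hip_symm hip_pos hh
  have h0 : ((unitOfEquiv (h 0) : (Model n →L[ℝ] Model n)ˣ) : Model n →L[ℝ] Model n) = 1 := by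
    rw [hh.1]; rfl
  have hbound : ∀ S : Set ℝ, MeasurableSet S → S ⊆ timeInterval Tminus Tplus →
      ∫⁻ t in S, tensorNorm n (pullForm (h t) ip) (q (γ t) o : MixedTensor r s (Model n)) ≠ ⊤ →
      ∫⁻ t in S, ‖gaugeOperator (m := m) q o sec (MixedTensor.pull e γ₀) L
        (unitOfEquiv (h t) : Model n →L[ℝ] Model n)‖ₑ < ⊤ := by
    intro S hS' hST hfin
    refine lt_of_le_of_lt (setLIntegral_mono_ae' hS' (Filter.Eventually.of_forall
      fun t ht => (hH t (hST ht)).2.2.2)) ?_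
    -- A finite constant leaves the integral without any measurability of the moving norm.
    rw [lintegral_const_mul' _ _ ENNReal.ofReal_ne_top]
    exact ENNReal.mul_lt_top ENNReal.ofReal_lt_top hfin.lt_top
  constructor
  · rintro ⟨hT, hsing⟩
    by_contra hfin
    lift Tplus to ℝ using ⟨hT.ne, ((EReal.bot_lt_zero).trans hplus).ne'⟩
    have hT0 : 0 < Tplus := EReal.coe_pos.mp hplus
    have hI : timeInterval 0 (Tplus : EReal) = Set.Ioo 0 Tplus := by
      ext t; simp [timeInterval]
    have hint := hbound _ (isOpen_timeInterval 0 (Tplus : EReal)).measurableSet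
      (fun t ht => ⟨hminus.trans ht.1, ht.2⟩) hfin
    rw [hI] at hint
    obtain ⟨b, hb, y, hy, hyH⟩ := hS.exists_extension (c := 1) (by simp) hminus hT0 h0
      (fun t ht => ⟨(hH t ht).2.1, (unitOfEquiv (h t)).isUnit, by
        rw [one_smul]; exact (hH t ht).2.2.1⟩) hint
    refine hsing ⟨b, fun t => gaugedField (m := m) o sec (MixedTensor.pull e γ₀) (y t),
      EReal.coe_lt_coe_iff.mpr hb, hS.isInvariantSolution_gaugedField fun t ht => ?_,
      fun t ht => ?_⟩
    · have h1 := hy t ht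
      rwa [one_smul] at h1
    · show gaugedField (m := m) o sec (MixedTensor.pull e γ₀) (y t) = γ t
      rw [hyH t ht, (hH t ht).1]
  · rintro ⟨hT, hsing⟩
    by_contra hfin
    lift Tminus to ℝ using ⟨(hminus.trans EReal.zero_lt_top).ne, hT.ne'⟩
    have hT0 : 0 < -Tminus := neg_pos.mpr (EReal.coe_neg'.mp hminus)
    have hint := hbound _ (isOpen_timeInterval (Tminus : EReal) 0).measurableSet
      (fun t ht => ⟨ht.1, ht.2.trans hplus⟩) hfin
    have hI : (fun t : ℝ => -t) ⁻¹' timeInterval (Tminus : EReal) 0 = Set.Ioo 0 (-Tminus) := by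
      ext t
      rw [Set.mem_preimage, neg_mem_timeInterval, neg_zero, ← EReal.coe_neg,
        mem_timeInterval_coe, EReal.coe_pos]
      rfl
    rw [← (Measure.measurePreserving_neg (volume : Measure ℝ)).setLIntegral_comp_preimage_emb
      (MeasurableEquiv.neg ℝ).measurableEmbedding] at hint
    replace hint := hI ▸ hint
    have hneg : ∀ {a b : EReal} {t : ℝ}, t ∈ timeInterval (-b) (-a) → -t ∈ timeInterval a b :=
      neg_mem_timeInterval.mpr
    -- The reversed curve `t ↦ h (-t)` solves `H' = R(H) H`, the gauge equation with sign `c = -1`,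
    -- and is continued forward past `-Tminus`.
    obtain ⟨b, hb, y, hy, hyH⟩ := hS.exists_extension (c := -1) (by simp) (a := -Tplus)
      (T := -Tminus) (by rw [EReal.neg_lt_comm, neg_zero]; exact hplus) hT0
      (H := fun t => (unitOfEquiv (h (-t)) : Model n →L[ℝ] Model n)) (by simpa using h0)
      (fun t ht => by
        have ht' := hneg (a := (Tminus : EReal)) ht
        refine ⟨(hH _ ht').2.1, (unitOfEquiv (h (-t))).isUnit, ?_⟩
        refine ((hH _ ht').2.2.1.scomp t (hasDerivAt_neg t)).congr_deriv ?_
        ext1 v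
        simp) hint
    refine hsing ⟨((-b : ℝ) : EReal),
      fun t => gaugedField (m := m) o sec (MixedTensor.pull e γ₀) (y (-t)),
      EReal.coe_lt_coe_iff.mpr (by linarith),
      hS.isInvariantSolution_gaugedField (y := fun t => y (-t)) fun t ht => ?_, fun t ht => ?_⟩
    · have ht' : -t ∈ timeInterval (-Tplus) (b : EReal) := by
        rw [neg_mem_timeInterval, neg_neg]; exact ht
      obtain ⟨h1, h2, h3⟩ := hy _ ht'
      refine ⟨h1, h2, (h3.scomp t (hasDerivAt_neg t)).congr_deriv ?_⟩
      ext1 v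
      simp
    · have ht' : -t ∈ timeInterval (-Tplus) ((-Tminus : ℝ) : EReal) := by
        rw [neg_mem_timeInterval, neg_neg, EReal.coe_neg, neg_neg]; exact ht
      have h1 := hyH _ ht'
      simp only [neg_neg] at h1
      show gaugedField (m := m) o sec (MixedTensor.pull e γ₀) (y (-t)) = γ t
      rw [h1, (hH t ht).1]

end Main

end HomogeneousFlow

end

theorem mainTheorem5 {N m n : ℕ} (r s : Fin N → ℕ)
    {G : Type*} [TopologicalSpace G] [ChartedSpace (HomogeneousFlow.Model m) G] [Group G]
    [LieGroup (𝓡 m) ∞ G]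
    {M : Type*} [TopologicalSpace M] [ChartedSpace (HomogeneousFlow.Model n) M]
    [IsManifold (𝓡 n) ∞ M] [MulAction G M] [ContMDiffSMul (𝓡 m) (𝓡 n) ∞ G M]
    (o : M) (hM : HomogeneousFlow.IsHomogeneousSpace (m := m) (n := n) G o)
    (γ₀ : HomogeneousFlow.MixedTensor r s (HomogeneousFlow.Model n))
    (𝔮 : Submodule ℝ (Module.End ℝ (HomogeneousFlow.Model n)))
    (h𝔮 : HomogeneousFlow.IsInvariantComplement γ₀ 𝔮)
    (q : HomogeneousFlow.TensorField n r s M → HomogeneousFlow.TensorField n r s M)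
    (hq : HomogeneousFlow.IsVelocity γ₀ q)
    (hdiff : HomogeneousFlow.IsDiffeomorphismInvariant γ₀ q)
    (hsmooth : HomogeneousFlow.IsSmoothOnInvariant (m := m) G γ₀ q o)
    (γ : ℝ → HomogeneousFlow.TensorField n r s M) (Tminus Tplus : EReal)
    (hminus : Tminus < 0) (hplus : 0 < Tplus)
    (hγ : HomogeneousFlow.IsInvariantSolution (m := m) G γ₀ q γ Tminus Tplus)
    (ip : LinearMap.BilinForm ℝ (TangentSpace (𝓡 n) o)) (hip_symm : ∀ v w, ip v w = ip w v)
    (hip_pos : ∀ v, v ≠ 0 → 0 < ip v v)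
    (h : ℝ → TangentSpace (𝓡 n) o ≃ₗ[ℝ] TangentSpace (𝓡 n) o)
    (hh : HomogeneousFlow.IsGaugeCurve γ₀ 𝔮 q γ Tminus Tplus o h) :
    (HomogeneousFlow.HasForwardSingularity (m := m) G γ₀ q γ Tminus Tplus →
      ∫⁻ t in HomogeneousFlow.timeInterval 0 Tplus,
        HomogeneousFlow.tensorNorm n (HomogeneousFlow.pullForm (h t) ip) (q (γ t) o) = ⊤) ∧
    (HomogeneousFlow.HasBackwardSingularity (m := m) G γ₀ q γ Tminus Tplus →
      ∫⁻ t in HomogeneousFlow.timeInterval Tminus 0,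
        HomogeneousFlow.tensorNorm n (HomogeneousFlow.pullForm (h t) ip) (q (γ t) o) = ⊤) := by
  exact hγ.lintegral_tensorNorm_eq_top hM h𝔮 hq hdiff hsmooth hminus hplus hip_symm hip_pos hh
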